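/- Let $d\ge 0$ be an integer, let $U\subset\mathbb{R}^2$ be an open neighbourhood of $0$, let $a_1,\dots,a_d:U\to\mathbb{R}$ be real analytic, and put $$P(x,y,z)=z^d+\sum_{i=1}^d a_i(x,y)\,z^{d-i}.$$ Assume that for every $(x,y)\in U$ all complex roots of $z\mapsto P(x,y,z)$ are real. For $N\in\mathbb{N}$ and $\delta>0$ put $$H_{N,\delta}=\{(x,y)\in\mathbb{R}^2:\ |x|<y^N,\ 0<y<\delta\}.$$ Then there are $N_0\in\mathbb{N}$ and $\delta_0>0$ such that for all integers $N\ge N_0$ and all $0<\delta\le\delta_0$ we have $H_{N,\delta}\subset U$, there exist real analytic functions $f_1,\dots,f_d:H_{N,\delta}\to\mathbb{R}$ with $$P(x,y,z)=\prod_{i=1}^d\bigl(z-f_i(x,y)\bigr)\qquad\text{for all }(x,y)\in H_{N,\delta},\ z\in\mathbb{R},\tag{1}$$ and for every choice of real analytic functions $f_1,\dots,f_d$ on $H_{N,\delta}$ satisfying (1) and every $i=1,\dots,d$: - the function $(0,\delta)\ni y\mapsto \frac{\partial f_i}{\partial x}(0,y)$ extends to a real analytic function on $(-\varepsilon,\delta)$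 for some $\varepsilon>0$; - the function $y\mapsto\frac{\partial f_i}{\partial x}(0,y)$ is bounded on $(0,\delta)$. -/

import Mathlib

/-- The monic polynomial `P(x,y,z) = z^d + ∑_{i=1}^d a_i(x,y) z^(d-i)` in `z`, at the parameter
`p = (x,y)`. Only the coefficient functions `a 1, …, a d` matter. -/
noncomputable def monicFamily (d : ℕ) (a : ℕ → ℝ × ℝ → ℝ) (p : ℝ × ℝ) : Polynomial ℝ :=
  Polynomial.X ^ d + ∑ i ∈ Finset.Icc 1 d, Polynomial.C (a i p) * Polynomial.X ^ (d - i)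

/-- A real polynomial is hyperbolic if all its complex roots are real. -/
def IsHyperbolicPoly (P : Polynomial ℝ) : Prop :=
  ∀ z : ℂ, Polynomial.aeval z P = 0 → z.im = 0

/-- The horned neighbourhood `{(x,y) : |x| < y^N, 0 < y < δ}` of the positive `y`-axis. -/
def hornSet (N : ℕ) (δ : ℝ) : Set (ℝ × ℝ) :=
  {p | |p.1| < p.2 ^ N ∧ 0 < p.2 ∧ p.2 < δ}

/-- `f_1, …, f_d` are real analytic on `H` and `P(x,y,z) = ∏ (z - f_i(x,y))` for all
`(x,y) ∈ H` and all real `z`. -/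
def IsAnalyticSplitting (d : ℕ) (a : ℕ → ℝ × ℝ → ℝ) (H : Set (ℝ × ℝ))
    (f : Fin d → ℝ × ℝ → ℝ) : Prop :=
  (∀ i, AnalyticOnNhd ℝ (f i) H) ∧
    ∀ p ∈ H, ∀ z : ℝ, (monicFamily d a p).eval z = ∏ i, (z - f i p)

/-- The function `y ↦ ∂f/∂x (0,y)`. -/
noncomputable def partialXAtZero (f : ℝ × ℝ → ℝ) (y : ℝ) : ℝ :=
  deriv (fun x : ℝ => f (x, y)) 0

/-! The mechanism is a resolution algorithm for hyperbolic germs, run by induction on the degree. A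
shift by the mean of the roots kills the subleading coefficient. Then the second coefficient is
minus half the sum of the squared roots, so it bounds every root. If all lower coefficients vanish
on a line `l = 0`, this nonpositive function is divisible by `l ^ 2`. Hence the roots are `O(|l|)`,
and every root can be divided by `l` within analytic hyperbolic families
(`HyperbolicFamily.exists_scaleRoots`). This is where real-rootedness enters.

Unless all lower coefficients vanish identically, three moves suffice. If they all vanish on the
`y`-axis, the roots are divided by `x`, which lowers the power of `x` in a chosen coefficient. If
some coefficient is nonzero on the axis but all vanish at the origin, the substitution `(x, y) ↦ (x
* y, y)` followed by division of the roots by `y` lowers the order of that coefficient in `y`. If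
the centered polynomial at the origin is not `X ^ d`, it has two distinct roots, and Hensel's lemma
(`HyperbolicFamily.exists_factorization`) lowers the degree.

Undoing the moves preserves more than analyticity on a horn. A root `x * f` has slope on the axis
equal to the value of `f`; a root `y * f (x / y, y)` has the same slope as `f`, since the factors
`y` and `1 / y` cancel. So it is enough to carry analytic extensions of value and slope together, as
in `HornRoot`. Each blow-up costs one unit in the exponent of the horn.

An arbitrary analytic splitting reduces to the constructed one because analytic functions on the
connected horn have no zero divisors (`IsAnalyticSplitting.exists_eqOn`). -/

open Filter Topology

/-! ### Hadamard's lemma for analytic germs -/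

/-- The `n`-th coefficient of the power series obtained by dividing `p (v, …, v) - p (π v, …, π v)`
by the linear form `v ↦ l v`, where `π v = v - l v • e`. -/
noncomputable def hadamardCoeff {E : Type*} [NormedAddCommGroup E] [NormedSpace ℝ E]
    (pr : E →L[ℝ] E) (e : E) {n : ℕ}
    (p : ContinuousMultilinearMap ℝ (fun _ : Fin (n + 1) => E) ℝ) :
    ContinuousMultilinearMap ℝ (fun _ : Fin n => E) ℝ :=
  ∑ j : Fin (n + 1), (p.compContinuousLinearMap
    (fun k => if k ≤ j then ContinuousLinearMap.id ℝ E else pr)).curryMid j e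

/-- Telescoping: `v` is replaced by `pr v` one slot at a time, and each replacement contributes `v -
pr v = t • e` in that slot. -/
theorem mul_hadamardCoeff {E : Type*} [NormedAddCommGroup E] [NormedSpace ℝ E]
    (pr : E →L[ℝ] E) (e : E) (t : ℝ) {n : ℕ}
    (p : ContinuousMultilinearMap ℝ (fun _ : Fin (n + 1) => E) ℝ) (v : E)
    (hv : v - pr v = t • e) :
    t * hadamardCoeff pr e p (fun _ => v) = p (fun _ => v) - p (fun _ => pr v) := by
  have key : ∀ j : Fin (n + 1), t * ((p.compContinuousLinearMap
      (fun k => if k ≤ j then ContinuousLinearMap.id ℝ E else pr)).curryMid j e) (fun _ => v)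
      = p (fun k => if (k : ℕ) < j + 1 then v else pr v)
        - p (fun k => if (k : ℕ) < j then v else pr v) := by
    intro j
    have h1 : (fun k : Fin (n + 1) => if (k : ℕ) < j + 1 then v else pr v)
        = Function.update (fun k : Fin (n + 1) => if (k : ℕ) < j then v else pr v) j v := by
      ext k
      by_cases hk : k = j
      · subst hk; simp
      · have : (k : ℕ) ≠ j := fun h => hk (Fin.ext h)
        simp only [Function.update_of_ne hk]
        congr 1
        simp only [eq_iff_iff]; omega
    have h2 : (fun k : Fin (n + 1) => if (k : ℕ) < j then v else pr v)
        = Function.update (fun k : Fin (n + 1) => if (k : ℕ) < j then v else pr v) j (pr v) := by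
      ext k
      by_cases hk : k = j
      · subst hk; simp
      · simp [Function.update_of_ne hk]
    rw [h1]
    conv_rhs => rw [h2]
    rw [Function.update_idem, ← ContinuousMultilinearMap.map_update_sub, hv,
      ContinuousMultilinearMap.map_update_smul, smul_eq_mul]
    congr 1
    simp only [ContinuousMultilinearMap.curryMid_apply,
      ContinuousMultilinearMap.compContinuousLinearMap_apply]
    congr 1
    ext k
    by_cases hk : k = j
    · subst hk; simp
    · have h3 : (k ≤ j) ↔ (k : ℕ) < j := by
        rw [Fin.le_def]
        have : (k : ℕ) ≠ j := fun h => hk (Fin.ext h)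
        omega
      obtain ⟨i, rfl⟩ := Fin.exists_succAbove_eq hk
      rw [Function.update_of_ne hk, Fin.insertNth_apply_succAbove]
      by_cases h4 : j.succAbove i ≤ j
      · rw [if_pos h4, if_pos (h3.1 h4)]; rfl
      · rw [if_neg h4, if_neg (fun h => h4 (h3.2 h))]
  unfold hadamardCoeff
  rw [_root_.sum_apply, Finset.mul_sum, Finset.sum_congr rfl (fun j _ => key j),
    Fin.sum_univ_eq_sum_range (fun j => p (fun k => if (k : ℕ) < j + 1 then v else pr v)
        - p (fun k => if (k : ℕ) < j then v else pr v)) (n + 1),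
    Finset.sum_range_sub (fun j : ℕ => p (fun k => if (k : ℕ) < j then v else pr v))]
  congr 2
  ext k
  simp [k.2]

theorem norm_hadamardCoeff_le {E : Type*} [NormedAddCommGroup E] [NormedSpace ℝ E]
    (pr : E →L[ℝ] E) (e : E) {n : ℕ}
    (p : ContinuousMultilinearMap ℝ (fun _ : Fin (n + 1) => E) ℝ) :
    ‖hadamardCoeff pr e p‖ ≤ (n + 1) * (‖p‖ * (1 + ‖pr‖) ^ (n + 1) * ‖e‖) := by
  refine (norm_sum_le _ _).trans ?_
  have : ∀ j : Fin (n + 1), ‖(p.compContinuousLinearMap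
      (fun k => if k ≤ j then ContinuousLinearMap.id ℝ E else pr)).curryMid j e‖
      ≤ ‖p‖ * (1 + ‖pr‖) ^ (n + 1) * ‖e‖ := by
    intro j
    refine (ContinuousLinearMap.le_opNorm _ _).trans ?_
    rw [ContinuousMultilinearMap.norm_curryMid]
    refine mul_le_mul_of_nonneg_right ?_ (norm_nonneg _)
    refine (ContinuousMultilinearMap.norm_compContinuousLinearMap_le _ _).trans ?_
    refine mul_le_mul_of_nonneg_left ?_ (norm_nonneg _)
    calc _ ≤ ∏ _k : Fin (n + 1), (1 + ‖pr‖) := by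
          refine Finset.prod_le_prod (fun _ _ => norm_nonneg _) (fun k _ => ?_)
          split_ifs
          · exact ContinuousLinearMap.norm_id_le.trans (by linarith [norm_nonneg pr])
          · linarith
      _ = _ := by simp
  refine (Finset.sum_le_sum (fun j _ => this j)).trans ?_
  simp

/-- Hadamard's lemma: an analytic function vanishing on the kernel of a linear form is divisible by
that form. -/
theorem AnalyticAt.exists_eq_linear_mul {E : Type*} [NormedAddCommGroup E] [NormedSpace ℝ E]
    (l : E →L[ℝ] ℝ) {G : E → ℝ} (hG : AnalyticAt ℝ G 0)
    (hz : ∀ᶠ v in 𝓝 (0 : E), l v = 0 → G v = 0) :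
    ∃ h : E → ℝ, AnalyticAt ℝ h 0 ∧ ∀ᶠ v in 𝓝 (0 : E), G v = l v * h v := by
  by_cases hl : l = 0
  · refine ⟨0, analyticAt_const, ?_⟩
    filter_upwards [hz] with v hv
    simpa [hl] using hv (by simp [hl])
  obtain ⟨e, he⟩ : ∃ e, l e = 1 := by
    obtain ⟨w, hw⟩ : ∃ w, l w ≠ 0 := by
      by_contra! h
      exact hl (ContinuousLinearMap.ext h)
    exact ⟨(l w)⁻¹ • w, by simp [hw]⟩
  set pr : E →L[ℝ] E := ContinuousLinearMap.id ℝ E - l.smulRight e with hpr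
  have hprv : ∀ v, v - pr v = l v • e := fun v => by simp [hpr]
  obtain ⟨p, hp⟩ := hG
  let q : FormalMultilinearSeries ℝ E ℝ := fun n => hadamardCoeff pr e (p (n + 1))
  obtain ⟨C, r, hC, hr, hCr⟩ := p.le_mul_pow_of_radius_pos hp.radius_pos
  have hq : 0 < q.radius := by
    set M := 1 + ‖pr‖ with hM
    have hM0 : 0 < M := by positivity
    -- The factor 2 absorbs `n + 1 ≤ 2 ^ (n + 1)`, and `M` absorbs the powers of `1 + ‖pr‖`.
    have hR : 0 < 1 / (2 * r * M) := by positivity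
    refine lt_of_lt_of_le (ENNReal.coe_pos.2 (show (0 : NNReal) < ⟨_, hR.le⟩ from hR))
      (q.le_radius_of_bound (C * ‖e‖ * (2 * r * M)) (fun n => ?_))
    change ‖hadamardCoeff pr e (p (n + 1))‖ * (1 / (2 * r * M)) ^ n ≤ _
    have h2 : ((n : ℝ) + 1) ≤ 2 ^ (n + 1) := by
      exact_mod_cast (Nat.lt_two_pow_self (n := n + 1)).le
    calc _ ≤ ((n + 1) * (C * r ^ (n + 1) * M ^ (n + 1) * ‖e‖)) * (1 / (2 * r * M)) ^ n := by
          gcongr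
          refine (norm_hadamardCoeff_le _ _ _).trans ?_
          gcongr
          exact hCr _
      _ ≤ (2 ^ (n + 1) * (C * r ^ (n + 1) * M ^ (n + 1) * ‖e‖)) * (1 / (2 * r * M)) ^ n := by
          gcongr
      _ = C * ‖e‖ * (2 * r * M) * ((2 * r * M) * (1 / (2 * r * M))) ^ n := by
          simp only [mul_pow, pow_succ]; ring
      _ = _ := by
          rw [mul_one_div_cancel (by positivity), one_pow, mul_one]
  refine ⟨q.sum, (q.hasFPowerSeriesOnBall hq).hasFPowerSeriesAt.analyticAt, ?_⟩
  obtain ⟨R, hR⟩ := hp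
  have hpr0 : Tendsto pr (𝓝 0) (𝓝 0) := by
    simpa using pr.continuous.tendsto 0
  have b1 := Metric.eball_mem_nhds (0 : E) hR.r_pos
  have b2 := Metric.eball_mem_nhds (0 : E) hq
  filter_upwards [b1, hpr0 b1, b2, hpr0.eventually hz] with v h1 h2 h3 h4
  have s1 := hR.hasSum h1
  have s2 := hR.hasSum h2
  have s3 := (q.hasFPowerSeriesOnBall hq).hasSum h3
  rw [zero_add] at s1 s2 s3
  have hlpr : l (pr v) = 0 := by simp [hpr, he]
  rw [h4 hlpr] at s2
  have s4 := s1.sub s2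
  -- The constant terms at `v` and `pr v` cancel, so the series may start in degree one, matching
  -- the index shift in `q`.
  rw [← hasSum_nat_add_iff' 1] at s4
  have s5 := s3.mul_left (l v)
  have : ∀ n, l v * (q n fun _ => v) = (p (n + 1) fun _ => v) - (p (n + 1) fun _ => pr v) :=
    fun n => mul_hadamardCoeff pr e (l v) (p (n + 1)) v (hprv v)
  simp only [this] at s5
  have h0 : (p 0 fun _ => v) = (p 0 fun _ => pr v) := congrArg _ (Subsingleton.elim _ _)
  have := s4.unique s5
  simpa [h0] using this

/-! ### Monic polynomials by coefficients, and hyperbolic families -/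

/-- The monic polynomial of degree `d` whose coefficients below `d` are given by `c`. -/
noncomputable def monicOfCoeffs (d : ℕ) (c : ℕ → ℝ) : Polynomial ℝ :=
  Polynomial.X ^ d + ∑ k ∈ Finset.range d, Polynomial.C (c k) * Polynomial.X ^ k

theorem degree_sum_range_lt (d : ℕ) (c : ℕ → ℝ) :
    (∑ k ∈ Finset.range d, Polynomial.C (c k) * Polynomial.X ^ k).degree < (d : WithBot ℕ) := by
  refine (Polynomial.degree_sum_le _ _).trans_lt ?_
  refine (Finset.sup_lt_iff (WithBot.bot_lt_coe d)).2 fun k hk => ?_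
  exact (Polynomial.degree_C_mul_X_pow_le _ _).trans_lt (WithBot.coe_lt_coe.2 (Finset.mem_range.1 hk))

theorem monic_monicOfCoeffs (d : ℕ) (c : ℕ → ℝ) : (monicOfCoeffs d c).Monic :=
  Polynomial.monic_X_pow_add (degree_sum_range_lt d c)

theorem natDegree_monicOfCoeffs (d : ℕ) (c : ℕ → ℝ) : (monicOfCoeffs d c).natDegree = d := by
  apply Polynomial.natDegree_eq_of_degree_eq_some
  unfold monicOfCoeffs
  rw [Polynomial.degree_add_eq_left_of_degree_lt] <;> rw [Polynomial.degree_X_pow]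
  exact degree_sum_range_lt d c

theorem coeff_monicOfCoeffs (d : ℕ) (c : ℕ → ℝ) {k : ℕ} (hk : k < d) :
    (monicOfCoeffs d c).coeff k = c k := by
  simp [monicOfCoeffs, Polynomial.coeff_X_pow, hk.ne, hk]

theorem monicOfCoeffs_coeff {d : ℕ} {p : Polynomial ℝ} (hp : p.Monic) (hd : p.natDegree = d) :
    monicOfCoeffs d p.coeff = p := by
  subst hd
  exact hp.as_sum.symm

/-- Monic polynomials of degree `d` depending analytically on a parameter near `0`, with only real
roots. -/
structure HyperbolicFamily {E : Type*} [NormedAddCommGroup E] [NormedSpace ℝ E] (d : ℕ)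
    (p : E → Polynomial ℝ) : Prop where
  monic : ∀ v, (p v).Monic
  natDegree_eq : ∀ v, (p v).natDegree = d
  analyticAt : ∀ k, AnalyticAt ℝ (fun v => (p v).coeff k) 0
  splits : ∀ᶠ v in 𝓝 (0 : E), (p v).Splits

theorem analyticAt_coeff_monicOfCoeffs {E : Type*} [NormedAddCommGroup E] [NormedSpace ℝ E]
    {d : ℕ} {c : E → ℕ → ℝ} {v : E} (hc : ∀ k < d, AnalyticAt ℝ (fun v => c v k) v) (k : ℕ) :
    AnalyticAt ℝ (fun v => (monicOfCoeffs d (c v)).coeff k) v := by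
  rcases lt_trichotomy k d with h | h | h
  · simpa only [coeff_monicOfCoeffs d _ h] using hc k h
  · subst h
    have : ∀ v, (monicOfCoeffs k (c v)).coeff k = 1 := fun v => by
      have := (monic_monicOfCoeffs k (c v)).coeff_natDegree
      rwa [natDegree_monicOfCoeffs] at this
    simpa only [this] using analyticAt_const
  · have : ∀ v, (monicOfCoeffs d (c v)).coeff k = 0 := fun v =>
      Polynomial.coeff_eq_zero_of_natDegree_lt (by rwa [natDegree_monicOfCoeffs])
    simpa only [this] using analyticAt_const

/-! ### Divisibility by powers of a linear form -/

theorem dense_linear_ne_zero {E : Type*} [NormedAddCommGroup E] [NormedSpace ℝ E]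
    {l : E →L[ℝ] ℝ} (hl : l ≠ 0) : Dense {v | l v ≠ 0} := by
  obtain ⟨e, he⟩ : ∃ e, l e ≠ 0 := by
    by_contra! h
    exact hl (ContinuousLinearMap.ext h)
  intro v
  by_cases hv : l v = 0
  · have : Tendsto (fun t : ℝ => v + t • e) (𝓝[≠] 0) (𝓝 v) := by
      have : Continuous (fun t : ℝ => v + t • e) := by fun_prop
      simpa using (this.tendsto 0).mono_left nhdsWithin_le_nhds
    refine mem_closure_of_tendsto this ?_
    filter_upwards [self_mem_nhdsWithin] with t ht
    simpa [hv, he] using ht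
  · exact subset_closure hv

/-- A closed condition which holds off a hyperplane near `0` holds everywhere near `0`. -/
theorem eventually_le_of_linear_ne_zero {E : Type*} [NormedAddCommGroup E] [NormedSpace ℝ E]
    {l : E →L[ℝ] ℝ} (hl : l ≠ 0) {f g : E → ℝ} (hf : ∀ᶠ v in 𝓝 (0 : E), ContinuousAt f v)
    (hg : ∀ᶠ v in 𝓝 (0 : E), ContinuousAt g v)
    (h : ∀ᶠ v in 𝓝 (0 : E), l v ≠ 0 → f v ≤ g v) : ∀ᶠ v in 𝓝 (0 : E), f v ≤ g v := by
  filter_upwards [hf, hg, h.eventually_nhds] with v h1 h2 h3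
  have hne : (𝓝[{v : E | l v ≠ 0}] v).NeBot :=
    mem_closure_iff_nhdsWithin_neBot.1 (dense_linear_ne_zero hl v)
  refine le_of_tendsto_of_tendsto (b := 𝓝[{v : E | l v ≠ 0}] v)
    (h1.tendsto.mono_left nhdsWithin_le_nhds) (h2.tendsto.mono_left nhdsWithin_le_nhds) ?_
  rw [EventuallyLE, eventually_nhdsWithin_iff]
  filter_upwards [h3] with w hw h4 using hw h4

theorem AnalyticAt.eventually_continuousAt' {E : Type*} [NormedAddCommGroup E] [NormedSpace ℝ E]
    {f : E → ℝ} (hf : AnalyticAt ℝ f 0) : ∀ᶠ v in 𝓝 (0 : E), ContinuousAt f v :=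
  hf.eventually_analyticAt.mono fun _ h => h.continuousAt

theorem AnalyticAt.eventually_eq_of_linear_ne_zero {E : Type*} [NormedAddCommGroup E]
    [NormedSpace ℝ E] {l : E →L[ℝ] ℝ} (hl : l ≠ 0) {f g : E → ℝ} (hf : AnalyticAt ℝ f 0)
    (hg : AnalyticAt ℝ g 0) (h : ∀ᶠ v in 𝓝 (0 : E), l v ≠ 0 → f v = g v) :
    ∀ᶠ v in 𝓝 (0 : E), f v = g v := by
  filter_upwards [eventually_le_of_linear_ne_zero hl hf.eventually_continuousAt'
    hg.eventually_continuousAt' (h.mono fun v hv h' => (hv h').le),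
    eventually_le_of_linear_ne_zero hl hg.eventually_continuousAt'
    hf.eventually_continuousAt' (h.mono fun v hv h' => (hv h').ge)] with v h1 h2
  exact le_antisymm h1 h2

/-- One factor `l` is split off at a time; the bound for the quotient is clear off the hyperplane
and extends to it by continuity. -/
theorem AnalyticAt.exists_eq_linear_pow_mul {E : Type*} [NormedAddCommGroup E] [NormedSpace ℝ E]
    {l : E →L[ℝ] ℝ} (hl : l ≠ 0) {C : ℝ} (i : ℕ) {G : E → ℝ} (hG : AnalyticAt ℝ G 0)
    (hb : ∀ᶠ v in 𝓝 (0 : E), |G v| ≤ C * |l v| ^ i) :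
    ∃ h : E → ℝ, AnalyticAt ℝ h 0 ∧ ∀ᶠ v in 𝓝 (0 : E), G v = l v ^ i * h v := by
  induction i generalizing G with
  | zero => exact ⟨G, hG, by simp⟩
  | succ i ih =>
    obtain ⟨h, hh, hGh⟩ := hG.exists_eq_linear_mul l (by
      filter_upwards [hb] with v hv hl
      simpa [hl] using hv)
    obtain ⟨h', hh', hhh'⟩ := ih hh (by
      refine eventually_le_of_linear_ne_zero hl
        (hh.eventually_continuousAt'.mono fun v hv => hv.abs)
        (Eventually.of_forall fun v => by fun_prop) ?_
      filter_upwards [hb, hGh] with v h1 h2 h3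
      rw [h2, abs_mul, pow_succ'] at h1
      have := abs_pos.2 h3
      nlinarith)
    refine ⟨h', hh', ?_⟩
    filter_upwards [hGh, hhh'] with v h1 h2
    rw [h1, h2, pow_succ']; ring

/-- A nonpositive analytic function vanishing on a hyperplane is divisible by the square of its
equation. -/
theorem AnalyticAt.exists_eq_linear_sq_mul {E : Type*} [NormedAddCommGroup E] [NormedSpace ℝ E]
    {l : E →L[ℝ] ℝ} (hl : l ≠ 0) {G : E → ℝ} (hG : AnalyticAt ℝ G 0)
    (hz : ∀ᶠ v in 𝓝 (0 : E), l v = 0 → G v = 0) (hneg : ∀ᶠ v in 𝓝 (0 : E), G v ≤ 0) :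
    ∃ h : E → ℝ, AnalyticAt ℝ h 0 ∧ ∀ᶠ v in 𝓝 (0 : E), G v = l v ^ 2 * h v := by
  obtain ⟨h, hh, hGh⟩ := hG.exists_eq_linear_mul l hz
  obtain ⟨e, he⟩ : ∃ e, 0 < l e := by
    by_contra! h
    exact hl (ContinuousLinearMap.ext fun v => le_antisymm (h v) (by simpa using h (-v)))
  -- Since `l * h ≤ 0`, the quotient `h` is nonpositive where `l > 0` and nonnegative where `l < 0`.
  -- By continuity it vanishes on the hyperplane, which permits a second division.
  obtain ⟨h', hh', hhh'⟩ := hh.exists_eq_linear_mul l (by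
    have hle : ∀ᶠ v in 𝓝 (0 : E), l v * h v ≤ 0 := by
      filter_upwards [hGh, hneg] with v h1 h2
      rwa [← h1]
    filter_upwards [hle.eventually_nhds, hh.eventually_continuousAt'] with v hv hc hlv
    have hline : Tendsto (fun t : ℝ => v + t • e) (𝓝 0) (𝓝 v) := by
      have : Continuous (fun t : ℝ => v + t • e) := by fun_prop
      simpa using this.tendsto 0
    have h1 := hline.eventually hv
    have h2 : Tendsto (fun t : ℝ => h (v + t • e)) (𝓝 0) (𝓝 (h v)) := hc.tendsto.comp hline
    apply le_antisymm
    · refine le_of_tendsto (h2.mono_left (nhdsWithin_le_nhds (s := Set.Ioi 0))) ?_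
      filter_upwards [nhdsWithin_le_nhds h1, self_mem_nhdsWithin] with t h3 h4
      have h5 : (0 : ℝ) < t * l e := mul_pos h4 he
      simp only [map_add, hlv, map_smul, smul_eq_mul, zero_add] at h3
      by_contra! h6
      nlinarith [mul_pos h5 h6]
    · refine ge_of_tendsto (h2.mono_left (nhdsWithin_le_nhds (s := Set.Iio 0))) ?_
      filter_upwards [nhdsWithin_le_nhds h1, self_mem_nhdsWithin] with t h3 h4
      have h5 : t * l e < 0 := mul_neg_of_neg_of_pos h4 he
      simp only [map_add, hlv, map_smul, smul_eq_mul, zero_add] at h3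
      by_contra! h6
      nlinarith [mul_pos_of_neg_of_neg h5 h6])
  refine ⟨h', hh', ?_⟩
  filter_upwards [hGh, hhh'] with v h1 h2
  rw [h1, h2]; ring

/-! ### Real-rootedness and bounds on roots -/

theorem two_mul_coeff_multiset_prod_X_sub_C (s : Multiset ℝ) (k : ℕ) (hk : s.card = k + 2) :
    2 * (s.map (fun r => Polynomial.X - Polynomial.C r)).prod.coeff k
      = s.sum ^ 2 - (s.map (· ^ 2)).sum := by
  induction s using Multiset.induction_on generalizing k with
  | empty => simp at hk
  | cons a t ih =>
    have ht : t.card = k + 1 := by simpa using hk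
    have hnext : (t.map (fun r => Polynomial.X - Polynomial.C r)).prod.coeff k = -t.sum := by
      have := Polynomial.multiset_prod_X_sub_C_coeff_card_pred t (by omega)
      rwa [ht, Nat.add_sub_cancel] at this
    simp only [Multiset.map_cons, Multiset.prod_cons, Multiset.sum_cons, sub_mul]
    cases k with
    | zero =>
      obtain ⟨b, rfl⟩ := Multiset.card_eq_one.1 ht
      simp [mul_comm]; ring
    | succ k =>
      have := ih k ht
      rw [Polynomial.coeff_sub, Polynomial.coeff_X_mul, Polynomial.coeff_C_mul, hnext]
      linarith

/-- The coefficients of a real-rooted polynomial with vanishing root sum are controlled by its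
second coefficient. -/
theorem Polynomial.Splits.coeff_bound_of_centered {p : Polynomial ℝ} (hs : p.Splits)
    (hm : p.Monic) {n : ℕ} (hn : p.natDegree = n + 2) (hc : p.coeff (n + 1) = 0) :
    p.coeff n ≤ 0 ∧ ∀ i ≤ n + 2,
      |p.coeff i| ≤ √(-2 * p.coeff n) ^ (n + 2 - i) * (n + 2).choose i := by
  have hcard : p.roots.card = n + 2 := by rw [← hn, hs.natDegree_eq_card_roots]
  have hprod := hs.eq_prod_roots_of_monic hm
  have h1 := two_mul_coeff_multiset_prod_X_sub_C p.roots n hcard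
  rw [← hprod] at h1
  have hsum : p.roots.sum = 0 := by
    have := Polynomial.multiset_prod_X_sub_C_coeff_card_pred p.roots (by omega)
    rw [← hprod, hcard, show n + 2 - 1 = n + 1 by omega, hc] at this
    linarith
  rw [hsum] at h1
  -- With zero root sum, `-2 * p.coeff n` is the sum of the squared roots, so it dominates each
  -- square.
  have h2 : ∀ r ∈ p.roots, r ^ 2 ≤ -2 * p.coeff n := by
    intro r hr
    have : r ^ 2 ≤ (p.roots.map (· ^ 2)).sum :=
      Multiset.single_le_sum (fun x hx => by
        obtain ⟨y, -, rfl⟩ := Multiset.mem_map.1 hx; positivity) _ (Multiset.mem_map_of_mem _ hr)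
    linarith
  have h3 : 0 ≤ (p.roots.map (· ^ 2)).sum := Multiset.sum_nonneg fun x hx => by
    obtain ⟨y, -, rfl⟩ := Multiset.mem_map.1 hx; positivity
  refine ⟨by linarith, fun i hi => ?_⟩
  have h4 := Polynomial.coeff_le_of_roots_le (f := RingHom.id ℝ) (p := p)
    (B := √(-2 * p.coeff n)) i hm (by simpa using hs) (fun z hz => by
      rw [Polynomial.map_id] at hz
      rw [Real.norm_eq_abs]
      exact Real.abs_le_sqrt (h2 z hz))
  rw [Polynomial.map_id, hn] at h4
  exact h4

/-- Each factor satisfies `‖z - r‖ ≥ |z.im|` because `r` is real. Unlike splitting itself, this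
inequality visibly passes to limits of coefficients, and `Polynomial.splits_of_abs_im_pow_le`
recovers splitting from it. -/
theorem Polynomial.Splits.abs_im_pow_le {p : Polynomial ℝ} (hs : p.Splits) (hm : p.Monic) (z : ℂ) :
    |z.im| ^ p.natDegree ≤ ‖Polynomial.aeval z p‖ := by
  rw [hs.natDegree_eq_card_roots]
  conv_rhs => rw [hs.eq_prod_roots_of_monic hm]
  generalize p.roots = s
  induction s using Multiset.induction_on with
  | empty => simp
  | cons a t ih =>
    simp only [Multiset.card_cons, Multiset.map_cons, Multiset.prod_cons, map_mul, norm_mul,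
      pow_succ']
    refine mul_le_mul ?_ ih (by positivity) (by positivity)
    simpa using Complex.abs_im_le_norm (z - a)

theorem Polynomial.splits_of_forall_complex_root {p : Polynomial ℝ}
    (h : ∀ z : ℂ, Polynomial.aeval z p = 0 → z.im = 0) : p.Splits := by
  refine Polynomial.Splits.of_splits_map (algebraMap ℝ ℂ) (IsAlgClosed.splits _) fun z hz => ?_
  refine ⟨z.re, Complex.ext rfl ?_⟩
  have := (Polynomial.mem_roots'.1 hz).2
  rw [Polynomial.IsRoot, Polynomial.eval_map_algebraMap] at this
  simpa using (h z this).symm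

theorem Polynomial.splits_of_abs_im_pow_le {p : Polynomial ℝ} {d : ℕ}
    (h : ∀ z : ℂ, |z.im| ^ d ≤ ‖Polynomial.aeval z p‖) : p.Splits := by
  refine Polynomial.splits_of_forall_complex_root fun z hz => ?_
  have := h z
  rw [hz, norm_zero] at this
  exact abs_eq_zero.1 (eq_zero_of_pow_eq_zero (le_antisymm this (by positivity)))

theorem continuousAt_aeval_of_coeff {E : Type*} [TopologicalSpace E] {d : ℕ}
    {p : E → Polynomial ℝ} (hd : ∀ v, (p v).natDegree = d) {v : E}
    (hc : ∀ k, ContinuousAt (fun v => (p v).coeff k) v) (z : ℂ) :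
    ContinuousAt (fun v => Polynomial.aeval z (p v)) v := by
  have : (fun v => Polynomial.aeval z (p v))
      = fun v => ∑ k ∈ Finset.range (d + 1), (p v).coeff k • z ^ k := by
    ext v
    rw [Polynomial.aeval_eq_sum_range, hd]
  rw [this]
  exact tendsto_finsetSum _ fun k _ => (hc k).smul continuousAt_const

/-- Real-rootedness of a continuous family extends across a hyperplane. -/
theorem eventually_splits_of_linear_ne_zero {E : Type*} [NormedAddCommGroup E] [NormedSpace ℝ E]
    {l : E →L[ℝ] ℝ} (hl : l ≠ 0) {d : ℕ} {p : E → Polynomial ℝ}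
    (hm : ∀ v, (p v).Monic) (hd : ∀ v, (p v).natDegree = d)
    (ha : ∀ k, AnalyticAt ℝ (fun v => (p v).coeff k) 0)
    (hs : ∀ᶠ v in 𝓝 (0 : E), l v ≠ 0 → (p v).Splits) :
    ∀ᶠ v in 𝓝 (0 : E), (p v).Splits := by
  have hcont : ∀ᶠ v in 𝓝 (0 : E), ∀ k, ContinuousAt (fun v => (p v).coeff k) v := by
    have : ∀ᶠ v in 𝓝 (0 : E), ∀ k ∈ Finset.range (d + 1),
        ContinuousAt (fun v => (p v).coeff k) v := by
      rw [eventually_all_finset]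
      exact fun k _ => (ha k).eventually_continuousAt'
    filter_upwards [this] with v hv k
    by_cases hk : k ∈ Finset.range (d + 1)
    · exact hv k hk
    · have : (fun v => (p v).coeff k) = fun _ => 0 := by
        ext w
        refine Polynomial.coeff_eq_zero_of_natDegree_lt ?_
        rw [hd]
        simpa using hk
      rw [this]
      exact continuousAt_const
  filter_upwards [hcont, hs.eventually_nhds] with v h1 h2
  have hne : (𝓝[{v : E | l v ≠ 0}] v).NeBot :=
    mem_closure_iff_nhdsWithin_neBot.1 (dense_linear_ne_zero hl v)
  refine Polynomial.splits_of_abs_im_pow_le (d := d) fun z => ?_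
  refine ge_of_tendsto (x := 𝓝[{v : E | l v ≠ 0}] v)
    ((continuousAt_aeval_of_coeff hd h1 z).norm.tendsto.mono_left nhdsWithin_le_nhds) ?_
  rw [eventually_nhdsWithin_iff]
  filter_upwards [h2] with w hw h4
  have := (hw h4).abs_im_pow_le (hm w) z
  rwa [hd] at this

/-! ### Dividing the roots by a linear form -/

/-- A centered hyperbolic family which is `X ^ d` on a hyperplane is obtained from another one by
scaling the roots with the equation of the hyperplane. -/
theorem HyperbolicFamily.exists_scaleRoots {E : Type*} [NormedAddCommGroup E] [NormedSpace ℝ E]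
    {l : E →L[ℝ] ℝ} (hl : l ≠ 0) {n : ℕ} {p : E → Polynomial ℝ} (hp : HyperbolicFamily (n + 2) p)
    (hc : ∀ᶠ v in 𝓝 (0 : E), (p v).coeff (n + 1) = 0)
    (hz : ∀ᶠ v in 𝓝 (0 : E), l v = 0 → ∀ k < n + 2, (p v).coeff k = 0) :
    ∃ q : E → Polynomial ℝ, HyperbolicFamily (n + 2) q ∧
      (∀ᶠ v in 𝓝 (0 : E), (q v).coeff (n + 1) = 0) ∧
      ∀ᶠ v in 𝓝 (0 : E), p v = (q v).scaleRoots (l v) := by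
  have hbound : ∀ᶠ v in 𝓝 (0 : E), (p v).coeff n ≤ 0 ∧ ∀ i ≤ n + 2,
      |(p v).coeff i| ≤ √(-2 * (p v).coeff n) ^ (n + 2 - i) * (n + 2).choose i := by
    filter_upwards [hc, hp.splits] with v h1 h2
    exact h2.coeff_bound_of_centered (hp.monic v) (hp.natDegree_eq v) h1
  obtain ⟨h, hh, hph⟩ := (hp.analyticAt n).exists_eq_linear_sq_mul hl
    (hz.mono fun v hv hlv => hv hlv n (by omega)) (hbound.mono fun v hv => hv.1)
  have hhb : ∀ᶠ v in 𝓝 (0 : E), |h v| < |h 0| + 1 :=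
    hh.continuousAt.abs.eventually_lt_const (by linarith)
  -- From `(p v).coeff n = l v ^ 2 * h v` with `|h v| < |h 0| + 1`, the root bound `√(-2 * (p
  -- v).coeff n)` is at most `B * |l v|`.
  set B := √(2 * (|h 0| + 1)) with hB
  have hcoef : ∀ i < n + 2, ∃ b : E → ℝ, AnalyticAt ℝ b 0 ∧
      ∀ᶠ v in 𝓝 (0 : E), (p v).coeff i = l v ^ (n + 2 - i) * b v := by
    intro i hi
    refine (hp.analyticAt i).exists_eq_linear_pow_mul hl
      (C := B ^ (n + 2 - i) * (n + 2).choose i) _ ?_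
    filter_upwards [hbound, hph, hhb] with v h1 h2 h3
    refine (h1.2 i hi.le).trans ?_
    have h4 : √(-2 * (p v).coeff n) ≤ B * |l v| := by
      rw [h2, hB, ← Real.sqrt_sq_eq_abs (l v), ← Real.sqrt_mul (by positivity)]
      apply Real.sqrt_le_sqrt
      have := neg_abs_le (h v)
      nlinarith [sq_nonneg (l v)]
    calc _ ≤ (B * |l v|) ^ (n + 2 - i) * (n + 2).choose i := by gcongr
      _ = _ := by rw [mul_pow]; ring
  choose! b hb hpb using hcoef
  have hpb' : ∀ᶠ v in 𝓝 (0 : E), ∀ i ∈ Finset.range (n + 2),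
      (p v).coeff i = l v ^ (n + 2 - i) * b i v := by
    rw [eventually_all_finset]
    exact fun i hi => hpb i (Finset.mem_range.1 hi)
  let q : E → Polynomial ℝ := fun v => monicOfCoeffs (n + 2) (fun i => b i v)
  have hqm : ∀ v, (q v).Monic := fun v => monic_monicOfCoeffs _ _
  have hqd : ∀ v, (q v).natDegree = n + 2 := fun v => natDegree_monicOfCoeffs _ _
  have hqa : ∀ k, AnalyticAt ℝ (fun v => (q v).coeff k) 0 :=
    fun k => analyticAt_coeff_monicOfCoeffs (c := fun v i => b i v) hb k
  have hpq : ∀ᶠ v in 𝓝 (0 : E), p v = (q v).scaleRoots (l v) := by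
    filter_upwards [hpb'] with v hv
    ext i
    rw [Polynomial.coeff_scaleRoots, hqd]
    rcases lt_trichotomy i (n + 2) with hi | rfl | hi
    · rw [hv i (Finset.mem_range.2 hi), coeff_monicOfCoeffs _ _ hi, mul_comm]
    · have h1 := (hp.monic v).coeff_natDegree
      have h2 := (hqm v).coeff_natDegree
      rw [hp.natDegree_eq] at h1
      rw [hqd] at h2
      rw [h1, h2]; simp
    · rw [Polynomial.coeff_eq_zero_of_natDegree_lt (by rwa [hp.natDegree_eq]),
        Polynomial.coeff_eq_zero_of_natDegree_lt (by rwa [hqd]), zero_mul]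
  refine ⟨q, ⟨hqm, hqd, hqa, ?_⟩, ?_, hpq⟩
  · refine eventually_splits_of_linear_ne_zero hl hqm hqd hqa ?_
    filter_upwards [hpq, hp.splits] with v h1 h2 h3
    -- Off the hyperplane the scaling is invertible, so `q v` inherits real roots from `p v`.
    have : q v = (p v).scaleRoots (l v)⁻¹ := by
      rw [h1, ← Polynomial.scaleRoots_mul, mul_inv_cancel₀ h3, Polynomial.scaleRoots_one]
    rw [this]
    exact h2.scaleRoots _
  · refine (hqa (n + 1)).eventually_eq_of_linear_ne_zero hl analyticAt_const ?_
    filter_upwards [hpq, hc] with v h1 h2 h3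
    rw [h1, Polynomial.coeff_scaleRoots, hqd] at h2
    simpa [h3] using h2

/-! ### Hensel's lemma via the inverse function theorem -/

theorem AnalyticAt.exists_right_inverse_of_injective_fderiv {E F : Type*} [NormedAddCommGroup E]
    [NormedSpace ℝ E] [FiniteDimensional ℝ E] [NormedAddCommGroup F] [NormedSpace ℝ F]
    [FiniteDimensional ℝ F] (hEF : Module.finrank ℝ E = Module.finrank ℝ F) {f : E → F} {a : E}
    (hf : AnalyticAt ℝ f a) (hinj : ∀ w, fderiv ℝ f a w = 0 → w = 0) :
    ∃ g : F → E, AnalyticAt ℝ g (f a) ∧ g (f a) = a ∧ ∀ᶠ y in 𝓝 (f a), f (g y) = y := by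
  have : CompleteSpace E := FiniteDimensional.complete ℝ E
  have : CompleteSpace F := FiniteDimensional.complete ℝ F
  have hi : Function.Injective (fderiv ℝ f a : E →ₗ[ℝ] F) := by
    rw [← LinearMap.ker_eq_bot, LinearMap.ker_eq_bot']
    exact hinj
  let e : E ≃L[ℝ] F := (LinearEquiv.ofInjectiveOfFinrankEq _ hi hEF).toContinuousLinearEquiv
  have he : (e : E →L[ℝ] F) = fderiv ℝ f a := by ext; rfl
  have hd : HasFDerivAt f (e : E →L[ℝ] F) a := by
    rw [he]; exact hf.differentiableAt.hasFDerivAt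
  have hc : ContDiffAt ℝ ⊤ f a := hf.contDiffAt
  exact ⟨hc.localInverse hd (by simp), (hc.to_localInverse hd (by simp)).analyticAt,
    hc.localInverse_apply_image hd (by simp),
    (hc.hasStrictFDerivAt' hd (by simp)).eventually_right_inverse⟩

/-- Extension of a finite vector of coefficients by zero. -/
noncomputable def extendCoeffs {m : ℕ} (a : Fin m → ℝ) (k : ℕ) : ℝ :=
  if h : k < m then a ⟨k, h⟩ else 0

/-- The monic polynomial of degree `m` with a given vector of lower coefficients. -/
noncomputable def monicOfVec {m : ℕ} (a : Fin m → ℝ) : Polynomial ℝ :=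
  monicOfCoeffs m (extendCoeffs a)

/-- The polynomial of degree less than `m` with a given vector of coefficients. -/
noncomputable def polyOfVec {m : ℕ} (a : Fin m → ℝ) : Polynomial ℝ :=
  ∑ k ∈ Finset.range m, Polynomial.C (extendCoeffs a k) * Polynomial.X ^ k

theorem monicOfVec_eq {m : ℕ} (a : Fin m → ℝ) :
    monicOfVec a = Polynomial.X ^ m + polyOfVec a := rfl

theorem polyOfVec_add_smul {m : ℕ} (a b : Fin m → ℝ) (t : ℝ) :
    polyOfVec (a + t • b) = polyOfVec a + Polynomial.C t * polyOfVec b := by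
  unfold polyOfVec
  rw [Finset.mul_sum, ← Finset.sum_add_distrib]
  refine Finset.sum_congr rfl fun k hk => ?_
  simp only [extendCoeffs, Finset.mem_range.1 hk, dif_pos, Pi.add_apply, Pi.smul_apply,
    smul_eq_mul, Polynomial.C_add, Polynomial.C_mul]
  ring

theorem coeff_polyOfVec {m : ℕ} (a : Fin m → ℝ) (i : Fin m) : (polyOfVec a).coeff i = a i := by
  simp [polyOfVec, extendCoeffs]

theorem monicOfVec_coeff {m : ℕ} {p : Polynomial ℝ} (hp : p.Monic) (hd : p.natDegree = m) :
    monicOfVec (fun i : Fin m => p.coeff i) = p := by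
  conv_rhs => rw [← monicOfCoeffs_coeff hp hd]
  unfold monicOfVec monicOfCoeffs
  congr 1
  refine Finset.sum_congr rfl fun k hk => ?_
  simp [extendCoeffs, Finset.mem_range.1 hk]

theorem analyticAt_coeff_monicOfVec {m : ℕ} (a : Fin m → ℝ) (k : ℕ) :
    AnalyticAt ℝ (fun a : Fin m → ℝ => (monicOfVec a).coeff k) a := by
  refine analyticAt_coeff_monicOfCoeffs (c := fun a : Fin m → ℝ => extendCoeffs a)
    (fun k hk => ?_) k
  simp only [extendCoeffs, hk, dif_pos]
  exact (ContinuousLinearMap.proj (R := ℝ) (φ := fun _ : Fin m => ℝ) ⟨k, hk⟩).analyticAt a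

/-- Multiplication of monic polynomials in terms of the lower coefficients. -/
noncomputable def mulCoeffs (m n : ℕ) (w : (Fin m → ℝ) × (Fin n → ℝ)) : Fin (m + n) → ℝ :=
  fun k => (monicOfVec w.1 * monicOfVec w.2).coeff k

theorem analyticAt_mulCoeffs (m n : ℕ) (w : (Fin m → ℝ) × (Fin n → ℝ)) :
    AnalyticAt ℝ (mulCoeffs m n) w := by
  rw [analyticAt_pi_iff]
  intro k
  simp only [mulCoeffs, Polynomial.coeff_mul]
  refine Finset.analyticAt_fun_sum _ fun x _ => ?_
  exact ((analyticAt_coeff_monicOfVec w.1 x.1).fun_comp analyticAt_fst).mul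
    ((analyticAt_coeff_monicOfVec w.2 x.2).fun_comp analyticAt_snd)

/-- Along a line `w + t • u` the product is quadratic in `t`; the derivative is its linear
coefficient. -/
theorem fderiv_mulCoeffs (m n : ℕ) (w u : (Fin m → ℝ) × (Fin n → ℝ)) (k : Fin (m + n)) :
    fderiv ℝ (mulCoeffs m n) w u k
      = (polyOfVec u.1 * monicOfVec w.2 + monicOfVec w.1 * polyOfVec u.2).coeff k := by
  have h1 : HasDerivAt (fun t : ℝ => mulCoeffs m n (w + t • u)) (fderiv ℝ (mulCoeffs m n) w u) 0 := by
    have hf : HasFDerivAt (mulCoeffs m n) (fderiv ℝ (mulCoeffs m n) w) (w + (0 : ℝ) • u) := by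
      simpa using (analyticAt_mulCoeffs m n w).differentiableAt.hasFDerivAt
    have hg : HasDerivAt (fun t : ℝ => w + t • u) u 0 := by
      simpa using ((hasDerivAt_id (0 : ℝ)).smul_const u).const_add w
    exact hf.comp_hasDerivAt (0 : ℝ) hg
  have h2 := (hasDerivAt_pi.1 h1) k
  have h3 : (fun t : ℝ => mulCoeffs m n (w + t • u) k) = fun t : ℝ =>
      (monicOfVec w.1 * monicOfVec w.2).coeff k
      + (polyOfVec u.1 * monicOfVec w.2 + monicOfVec w.1 * polyOfVec u.2).coeff k * t
      + (polyOfVec u.1 * polyOfVec u.2).coeff k * t ^ 2 := by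
    ext t
    have : monicOfVec (w + t • u).1 * monicOfVec (w + t • u).2
        = monicOfVec w.1 * monicOfVec w.2
        + Polynomial.C t * (polyOfVec u.1 * monicOfVec w.2 + monicOfVec w.1 * polyOfVec u.2)
        + Polynomial.C (t ^ 2) * (polyOfVec u.1 * polyOfVec u.2) := by
      simp only [monicOfVec_eq, Prod.fst_add, Prod.snd_add, Prod.smul_fst, Prod.smul_snd,
        polyOfVec_add_smul, Polynomial.C_pow]
      ring
    rw [mulCoeffs, this]
    simp only [Polynomial.coeff_add, Polynomial.coeff_C_mul]
    ring
  rw [h3] at h2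
  refine h2.unique ?_
  have h4 := (((hasDerivAt_id (0 : ℝ)).const_mul ((polyOfVec u.1 * monicOfVec w.2
    + monicOfVec w.1 * polyOfVec u.2).coeff k)).const_add
    ((monicOfVec w.1 * monicOfVec w.2).coeff k)).fun_add
    ((hasDerivAt_pow 2 (0 : ℝ)).const_mul ((polyOfVec u.1 * polyOfVec u.2).coeff k))
  simpa using h4

theorem eq_zero_of_polyOfVec_eq_zero {m : ℕ} {a : Fin m → ℝ} (h : polyOfVec a = 0) : a = 0 := by
  ext i
  rw [← coeff_polyOfVec a i, h]; simp

/-- A kernel vector gives a relation `u₁ * w₂ + w₁ * u₂ = 0`. By coprimality each `wᵢ` divides the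
corresponding `uᵢ`, which has smaller degree and so is zero. -/
theorem injective_fderiv_mulCoeffs {m n : ℕ} {w : (Fin m → ℝ) × (Fin n → ℝ)}
    (hw : IsCoprime (monicOfVec w.1) (monicOfVec w.2)) (u : (Fin m → ℝ) × (Fin n → ℝ))
    (hu : fderiv ℝ (mulCoeffs m n) w u = 0) : u = 0 := by
  have hm1 : (monicOfVec w.1).Monic := monic_monicOfCoeffs _ _
  have hm2 : (monicOfVec w.2).Monic := monic_monicOfCoeffs _ _
  have hd1 : (monicOfVec w.1).degree = m := by
    rw [Polynomial.degree_eq_natDegree hm1.ne_zero, monicOfVec, natDegree_monicOfCoeffs]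
  have hd2 : (monicOfVec w.2).degree = n := by
    rw [Polynomial.degree_eq_natDegree hm2.ne_zero, monicOfVec, natDegree_monicOfCoeffs]
  have hu1 : (polyOfVec u.1).degree < m := degree_sum_range_lt _ _
  have hu2 : (polyOfVec u.2).degree < n := degree_sum_range_lt _ _
  have hzero : polyOfVec u.1 * monicOfVec w.2 + monicOfVec w.1 * polyOfVec u.2 = 0 := by
    have hdeg : (polyOfVec u.1 * monicOfVec w.2 + monicOfVec w.1 * polyOfVec u.2).degree
        < ((m + n : ℕ) : WithBot ℕ) := by
      refine (Polynomial.degree_add_le _ _).trans_lt (max_lt ?_ ?_)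
      · rw [hm2.degree_mul, hd2, Nat.cast_add]
        exact WithBot.add_lt_add_right (WithBot.coe_ne_bot (a := n)) hu1
      · rw [mul_comm, hm1.degree_mul, hd1, Nat.cast_add, add_comm (m : WithBot ℕ)]
        exact WithBot.add_lt_add_right (WithBot.coe_ne_bot (a := m)) hu2
    ext k
    rw [Polynomial.coeff_zero]
    by_cases hk : k < m + n
    · rw [← fderiv_mulCoeffs m n w u ⟨k, hk⟩, hu]; rfl
    · exact Polynomial.coeff_eq_zero_of_degree_lt
        (hdeg.trans_le (WithBot.coe_le_coe.2 (not_lt.1 hk)))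
  have h1 : polyOfVec u.1 = 0 := by
    refine Polynomial.eq_zero_of_dvd_of_degree_lt (p := monicOfVec w.1) ?_ (by rwa [hd1])
    refine hw.dvd_of_dvd_mul_right ⟨-polyOfVec u.2, ?_⟩
    linear_combination hzero
  have h2 : polyOfVec u.2 = 0 := by
    refine Polynomial.eq_zero_of_dvd_of_degree_lt (p := monicOfVec w.2) ?_ (by rwa [hd2])
    refine hw.symm.dvd_of_dvd_mul_left ⟨-polyOfVec u.1, ?_⟩
    linear_combination hzero
  exact Prod.ext (eq_zero_of_polyOfVec_eq_zero h1) (eq_zero_of_polyOfVec_eq_zero h2)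

/-- Hensel's lemma for hyperbolic families: a coprime factorization at the base point extends. -/
theorem HyperbolicFamily.exists_factorization {E : Type*} [NormedAddCommGroup E] [NormedSpace ℝ E]
    {m n : ℕ} {p : E → Polynomial ℝ} (hp : HyperbolicFamily (m + n) p) {q₀ r₀ : Polynomial ℝ}
    (hq : q₀.Monic) (hr : r₀.Monic) (hqd : q₀.natDegree = m) (hrd : r₀.natDegree = n)
    (hco : IsCoprime q₀ r₀) (hp0 : p 0 = q₀ * r₀) :
    ∃ q r : E → Polynomial ℝ, HyperbolicFamily m q ∧ HyperbolicFamily n r ∧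
      ∀ᶠ v in 𝓝 (0 : E), p v = q v * r v := by
  set w : (Fin m → ℝ) × (Fin n → ℝ) := (fun i => q₀.coeff i, fun i => r₀.coeff i) with hw
  have hw1 : monicOfVec w.1 = q₀ := monicOfVec_coeff hq hqd
  have hw2 : monicOfVec w.2 = r₀ := monicOfVec_coeff hr hrd
  obtain ⟨g, hg, -, hgr⟩ := (analyticAt_mulCoeffs m n w).exists_right_inverse_of_injective_fderiv
    (by simp) (injective_fderiv_mulCoeffs (by rwa [hw1, hw2]))
  let c : E → Fin (m + n) → ℝ := fun v i => (p v).coeff i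
  have hc : AnalyticAt ℝ c 0 := analyticAt_pi_iff.2 fun i => hp.analyticAt i
  have hc0 : c 0 = mulCoeffs m n w := by
    ext i
    simp only [c, mulCoeffs, hw1, hw2, hp0]
  rw [← hc0] at hg hgr
  have hgc : AnalyticAt ℝ (fun v => g (c v)) 0 := hg.fun_comp hc
  let q : E → Polynomial ℝ := fun v => monicOfVec (g (c v)).1
  let r : E → Polynomial ℝ := fun v => monicOfVec (g (c v)).2
  have hqm : ∀ v, (q v).Monic := fun v => monic_monicOfCoeffs _ _
  have hrm : ∀ v, (r v).Monic := fun v => monic_monicOfCoeffs _ _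
  have hqd' : ∀ v, (q v).natDegree = m := fun v => natDegree_monicOfCoeffs _ _
  have hrd' : ∀ v, (r v).natDegree = n := fun v => natDegree_monicOfCoeffs _ _
  have hpqr : ∀ᶠ v in 𝓝 (0 : E), p v = q v * r v := by
    filter_upwards [hc.continuousAt.eventually hgr] with v hv
    have h1 : (q v * r v).natDegree = m + n := by
      rw [(hqm v).natDegree_mul (hrm v), hqd', hrd']
    rw [← monicOfVec_coeff (hp.monic v) (hp.natDegree_eq v),
      ← monicOfVec_coeff ((hqm v).mul (hrm v)) h1]
    exact congrArg _ hv.symm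
  refine ⟨q, r, ⟨hqm, hqd', fun k => ?_, ?_⟩, ⟨hrm, hrd', fun k => ?_, ?_⟩, hpqr⟩
  · exact (analyticAt_coeff_monicOfVec _ k).fun_comp (analyticAt_fst.fun_comp hgc)
  · filter_upwards [hpqr, hp.splits] with v h1 h2
    exact h2.of_dvd (hp.monic v).ne_zero ⟨r v, h1⟩
  · exact (analyticAt_coeff_monicOfVec _ k).fun_comp (analyticAt_snd.fun_comp hgc)
  · filter_upwards [hpqr, hp.splits] with v h1 h2
    exact h2.of_dvd (hp.monic v).ne_zero ⟨q v, by rw [h1, mul_comm]⟩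

/-! ### Horn roots and how they transform -/

/-- A function analytic on a horn, whose value and first `x`-derivative on the `y`-axis extend
analytically to the origin. -/
structure HornRoot (N : ℕ) (δ : ℝ) (f : ℝ × ℝ → ℝ) : Prop where
  analyticOnNhd : AnalyticOnNhd ℝ f (hornSet N δ)
  value : ∃ g : ℝ → ℝ, AnalyticAt ℝ g 0 ∧ ∀ᶠ y in 𝓝[>] (0 : ℝ), f (0, y) = g y
  slope : ∃ g : ℝ → ℝ, AnalyticAt ℝ g 0 ∧ ∀ᶠ y in 𝓝[>] (0 : ℝ), partialXAtZero f y = g y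

/-- The family `p` splits on the horn with parameters `N`, `δ` into linear factors given by
horn roots. -/
def HornSplitOn (N : ℕ) (δ : ℝ) (p : ℝ × ℝ → Polynomial ℝ) : Prop :=
  ∃ s : Multiset (ℝ × ℝ → ℝ), (∀ f ∈ s, HornRoot N δ f) ∧
    ∀ v ∈ hornSet N δ, p v = (s.map fun f => Polynomial.X - Polynomial.C (f v)).prod

/-- The family `p` splits into horn roots on some horn. -/
def HornSplit (p : ℝ × ℝ → Polynomial ℝ) : Prop :=
  ∃ (N : ℕ) (δ : ℝ), 0 < δ ∧ HornSplitOn N δ p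

theorem hornSet_subset_hornSet {N N' : ℕ} {δ δ' : ℝ} (hN : N ≤ N') (hδ : δ' ≤ δ) (h1 : δ' ≤ 1) :
    hornSet N' δ' ⊆ hornSet N δ := fun _ ⟨h2, h3, h4⟩ =>
  ⟨h2.trans_le (pow_le_pow_of_le_one h3.le (h4.le.trans h1) hN), h3, h4.trans_le hδ⟩

theorem exists_hornSet_subset {S : Set (ℝ × ℝ)} (hS : S ∈ 𝓝 (0 : ℝ × ℝ)) :
    ∃ δ : ℝ, 0 < δ ∧ δ ≤ 1 ∧ hornSet 1 δ ⊆ S := by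
  obtain ⟨ε, hε, h⟩ := Metric.mem_nhds_iff.1 hS
  refine ⟨min ε 1, by positivity, min_le_right _ _, fun v hv => h ?_⟩
  obtain ⟨h2, h3, h4⟩ := hv
  rw [pow_one] at h2
  have h5 := h4.trans_le (min_le_left _ _)
  rw [mem_ball_zero_iff, Prod.norm_def]
  exact max_lt (h2.trans h5) (by rwa [Real.norm_eq_abs, abs_of_pos h3])

theorem isOpen_hornSet (N : ℕ) (δ : ℝ) : IsOpen (hornSet N δ) := by
  have h1 : IsOpen {p : ℝ × ℝ | |p.1| < p.2 ^ N} := isOpen_lt (by fun_prop) (by fun_prop)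
  have h2 : IsOpen {p : ℝ × ℝ | 0 < p.2} := isOpen_lt (by fun_prop) (by fun_prop)
  have h3 : IsOpen {p : ℝ × ℝ | p.2 < δ} := isOpen_lt (by fun_prop) (by fun_prop)
  exact h1.inter (h2.inter h3)

theorem mem_hornSet_axis {N : ℕ} {δ y : ℝ} (hy : y ∈ Set.Ioo 0 δ) :
    ((0 : ℝ), y) ∈ hornSet N δ :=
  ⟨by simpa using pow_pos hy.1 N, hy.1, hy.2⟩

theorem HornRoot.mono {N N' : ℕ} {δ δ' : ℝ} {f : ℝ × ℝ → ℝ} (hf : HornRoot N δ f)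
    (h : hornSet N' δ' ⊆ hornSet N δ) : HornRoot N' δ' f :=
  ⟨hf.analyticOnNhd.mono h, hf.value, hf.slope⟩

theorem HornSplitOn.mono {N N' : ℕ} {δ δ' : ℝ} {p : ℝ × ℝ → Polynomial ℝ} (hp : HornSplitOn N δ p)
    (h : hornSet N' δ' ⊆ hornSet N δ) : HornSplitOn N' δ' p := by
  obtain ⟨s, h1, h2⟩ := hp
  exact ⟨s, fun f hf => (h1 f hf).mono h, fun v hv => h2 v (h hv)⟩

theorem HornSplit.shrink {p : ℝ × ℝ → Polynomial ℝ} (hp : HornSplit p) {S : Set (ℝ × ℝ)}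
    (hS : S ∈ 𝓝 (0 : ℝ × ℝ)) :
    ∃ (N : ℕ) (δ : ℝ), 0 < δ ∧ δ ≤ 1 ∧ hornSet N δ ⊆ S ∧ HornSplitOn N δ p := by
  obtain ⟨N, δ, hδ, h⟩ := hp
  obtain ⟨δ', hδ', h1, h2⟩ := exists_hornSet_subset hS
  refine ⟨max N 1, min δ δ', by positivity, (min_le_right _ _).trans h1,
    (hornSet_subset_hornSet (le_max_right _ _) (min_le_right _ _)
      ((min_le_right _ _).trans h1)).trans h2,
    h.mono (hornSet_subset_hornSet (le_max_left _ _) (min_le_left _ _)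
      ((min_le_right _ _).trans h1))⟩

theorem HornSplit.of_mul {p q r : ℝ × ℝ → Polynomial ℝ} (hq : HornSplit q) (hr : HornSplit r)
    (h : ∀ᶠ v in 𝓝 (0 : ℝ × ℝ), p v = q v * r v) : HornSplit p := by
  obtain ⟨N, δ, hδ, hδ1, hS, hq⟩ := hq.shrink h
  obtain ⟨N', δ', hδ', hδ1', -, hr⟩ := hr.shrink h
  have h1 : hornSet (max N N') (min δ δ') ⊆ hornSet N δ := hornSet_subset_hornSet
    (le_max_left _ _) (min_le_left _ _) ((min_le_left _ _).trans hδ1)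
  have h2 : hornSet (max N N') (min δ δ') ⊆ hornSet N' δ' := hornSet_subset_hornSet
    (le_max_right _ _) (min_le_right _ _) ((min_le_left _ _).trans hδ1)
  obtain ⟨s, hs, hs'⟩ := hq.mono h1
  obtain ⟨t, ht, ht'⟩ := hr.mono h2
  refine ⟨max N N', min δ δ', lt_min hδ hδ', s + t, fun f hf => ?_, fun v hv => ?_⟩
  · exact (Multiset.mem_add.1 hf).elim (hs f) (ht f)
  · rw [Multiset.map_add, Multiset.prod_add, ← hs' v hv, ← ht' v hv]
    exact hS (h1 hv)

theorem hornRoot_zero (N : ℕ) (δ : ℝ) : HornRoot N δ 0 :=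
  ⟨fun _ _ => analyticAt_const, ⟨0, analyticAt_const, by simp⟩,
    ⟨0, analyticAt_const, by simp [partialXAtZero]⟩⟩

theorem hornSplit_X_pow {p : ℝ × ℝ → Polynomial ℝ} {d : ℕ}
    (h : ∀ᶠ v in 𝓝 (0 : ℝ × ℝ), p v = Polynomial.X ^ d) : HornSplit p := by
  obtain ⟨δ, hδ, -, hS⟩ := exists_hornSet_subset h
  refine ⟨1, δ, hδ, Multiset.replicate d 0, fun f hf => ?_, fun v hv => ?_⟩
  · rw [Multiset.eq_of_mem_replicate hf]
    exact hornRoot_zero _ _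
  · simpa using hS hv

theorem partialXAtZero_eq_fderiv {f : ℝ × ℝ → ℝ} {y : ℝ} (hf : DifferentiableAt ℝ f (0, y)) :
    partialXAtZero f y = fderiv ℝ f (0, y) (1, 0) := by
  have h1 : HasDerivAt (fun x : ℝ => (x, y)) (1, 0) 0 :=
    (hasDerivAt_id (0 : ℝ)).prodMk (hasDerivAt_const _ _)
  exact (HasFDerivAt.comp_hasDerivAt (0 : ℝ) (f := fun x : ℝ => (x, y)) hf.hasFDerivAt h1).deriv

theorem HornRoot.eventually_analyticAt {N : ℕ} {δ : ℝ} (hδ : 0 < δ) {f : ℝ × ℝ → ℝ}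
    (hf : HornRoot N δ f) : ∀ᶠ y in 𝓝[>] (0 : ℝ), AnalyticAt ℝ f (0, y) := by
  filter_upwards [Ioo_mem_nhdsGT hδ] with y hy
  exact hf.analyticOnNhd _ (mem_hornSet_axis hy)

theorem AnalyticAt.hornRoot {N : ℕ} {δ : ℝ} {c : ℝ × ℝ → ℝ} (hc : AnalyticAt ℝ c 0)
    (h : AnalyticOnNhd ℝ c (hornSet N δ)) : HornRoot N δ c := by
  have hax : AnalyticAt ℝ (fun y : ℝ => ((0 : ℝ), y)) 0 := analyticAt_const.prod analyticAt_id
  refine ⟨h, ⟨fun y => c (0, y), ?_, Eventually.of_forall fun _ => rfl⟩,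
    ⟨fun y => fderiv ℝ c (0, y) (1, 0), ?_, ?_⟩⟩
  · exact AnalyticAt.fun_comp (g := c) (f := fun y : ℝ => ((0 : ℝ), y)) hc hax
  · have : AnalyticAt ℝ (fun y : ℝ => fderiv ℝ c (0, y)) 0 :=
      AnalyticAt.fun_comp (g := fderiv ℝ c) (f := fun y : ℝ => ((0 : ℝ), y)) hc.fderiv hax
    exact (ContinuousLinearMap.apply ℝ ℝ ((1 : ℝ), (0 : ℝ))).analyticAt _ |>.fun_comp this
  · have h1 : ∀ᶠ y in 𝓝 (0 : ℝ), AnalyticAt ℝ c (0, y) :=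
      hax.continuousAt.eventually (p := fun v => AnalyticAt ℝ c v) hc.eventually_analyticAt
    filter_upwards [nhdsWithin_le_nhds h1] with y hy
    exact partialXAtZero_eq_fderiv hy.differentiableAt

theorem HornRoot.add {N : ℕ} {δ : ℝ} (hδ : 0 < δ) {f g : ℝ × ℝ → ℝ} (hf : HornRoot N δ f)
    (hg : HornRoot N δ g) : HornRoot N δ (fun v => f v + g v) := by
  obtain ⟨a, ha, ha'⟩ := hf.value
  obtain ⟨b, hb, hb'⟩ := hg.value
  obtain ⟨a₁, ha₁, ha₁'⟩ := hf.slope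
  obtain ⟨b₁, hb₁, hb₁'⟩ := hg.slope
  refine ⟨fun v hv => (hf.analyticOnNhd v hv).add (hg.analyticOnNhd v hv),
    ⟨_, ha.add hb, ?_⟩, ⟨_, ha₁.add hb₁, ?_⟩⟩
  · filter_upwards [ha', hb'] with y h1 h2
    simp [h1, h2]
  · filter_upwards [ha₁', hb₁', hf.eventually_analyticAt hδ, hg.eventually_analyticAt hδ]
      with y h1 h2 h3 h4
    have h5 := partialXAtZero_eq_fderiv h3.differentiableAt
    have h6 := partialXAtZero_eq_fderiv h4.differentiableAt
    rw [partialXAtZero_eq_fderiv (h3.differentiableAt.fun_add h4.differentiableAt),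
      fderiv_fun_add h3.differentiableAt h4.differentiableAt]
    simp [← h5, ← h6, h1, h2]

theorem HornSplit.of_comp {p q : ℝ × ℝ → Polynomial ℝ} (hq : HornSplit q) {c : ℝ × ℝ → ℝ}
    (hc : AnalyticAt ℝ c 0)
    (h : ∀ᶠ v in 𝓝 (0 : ℝ × ℝ), p v = (q v).comp (Polynomial.X - Polynomial.C (c v))) :
    HornSplit p := by
  obtain ⟨N, δ, hδ, -, hS, s, hs, hs'⟩ := hq.shrink (h.and hc.eventually_analyticAt)
  have hcr : HornRoot N δ c := hc.hornRoot fun v hv => (hS hv).2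
  refine ⟨N, δ, hδ, s.map fun f v => f v + c v, fun g hg => ?_, fun v hv => ?_⟩
  · obtain ⟨f, hf, rfl⟩ := Multiset.mem_map.1 hg
    exact (hs f hf).add hδ hcr
  · rw [(hS hv).1, hs' v hv, Polynomial.multiset_prod_comp, Multiset.map_map, Multiset.map_map]
    congr 1
    refine Multiset.map_congr rfl fun f _ => ?_
    simp only [Function.comp_apply, Polynomial.sub_comp, Polynomial.X_comp, Polynomial.C_comp,
      Polynomial.C_add]
    ring

theorem scaleRoots_multiset_prod_X_sub_C {ι : Type*} (s : Multiset ι) (f : ι → ℝ) (t : ℝ) :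
    (s.map fun i => Polynomial.X - Polynomial.C (f i)).prod.scaleRoots t
      = (s.map fun i => Polynomial.X - Polynomial.C (t * f i)).prod := by
  induction s using Multiset.induction_on with
  | empty => simp
  | cons a s ih =>
    simp only [Multiset.map_cons, Multiset.prod_cons]
    rw [Polynomial.mul_scaleRoots_of_noZeroDivisors, ih, Polynomial.X_sub_C_scaleRoots, mul_comm t]

/-- The new root `x * f` is zero on the axis, and by the product rule its slope there is the value
of `f`: this is why `HornRoot` records `value`. -/
theorem HornSplit.of_scaleRoots_fst {p q : ℝ × ℝ → Polynomial ℝ} (hq : HornSplit q)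
    (h : ∀ᶠ v in 𝓝 (0 : ℝ × ℝ), p v = (q v).scaleRoots v.1) : HornSplit p := by
  obtain ⟨N, δ, hδ, -, hS, s, hs, hs'⟩ := hq.shrink h
  refine ⟨N, δ, hδ, s.map fun f v => v.1 * f v, fun g hg => ?_, fun v hv => ?_⟩
  · obtain ⟨f, hf, rfl⟩ := Multiset.mem_map.1 hg
    have hf := hs f hf
    refine ⟨fun v hv => analyticAt_fst.mul (hf.analyticOnNhd v hv),
      ⟨0, analyticAt_const, by simp⟩, ?_⟩
    obtain ⟨g, hg, hg'⟩ := hf.value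
    refine ⟨g, hg, ?_⟩
    filter_upwards [hg', hf.eventually_analyticAt hδ] with y h1 h2
    have h3 : HasDerivAt (fun x : ℝ => (x, y)) (1, 0) 0 :=
      (hasDerivAt_id (0 : ℝ)).prodMk (hasDerivAt_const _ _)
    have h4 := HasFDerivAt.comp_hasDerivAt (0 : ℝ) (f := fun x : ℝ => (x, y))
      h2.differentiableAt.hasFDerivAt h3
    have h5 := ((hasDerivAt_id (0 : ℝ)).mul h4).deriv
    rw [← h1]
    simpa using! h5
  · rw [hS hv, hs' v hv, scaleRoots_multiset_prod_X_sub_C s (fun f => f v), Multiset.map_map]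
    rfl

/-- The new root `y * f (x / y, y)` has value `y * f (0, y)` on the axis and the same slope as `f`,
by the chain rule. -/
theorem HornSplit.of_blowup {p q : ℝ × ℝ → Polynomial ℝ} (hq : HornSplit q)
    (h : ∀ᶠ v in 𝓝 (0 : ℝ × ℝ), p (v.1 * v.2, v.2) = (q v).scaleRoots v.2) : HornSplit p := by
  obtain ⟨N, δ, hδ, -, hS, s, hs, hs'⟩ := hq.shrink h
  -- Dividing `x` by `y` costs one power of `y`, hence the exponent `N + 1`.
  have hmem : ∀ v ∈ hornSet (N + 1) δ, (v.1 / v.2, v.2) ∈ hornSet N δ := by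
    rintro v ⟨h1, h2, h3⟩
    refine ⟨?_, h2, h3⟩
    rw [abs_div, abs_of_pos h2, div_lt_iff₀ h2, ← pow_succ]
    exact h1
  refine ⟨N + 1, δ, hδ, s.map fun f v => v.2 * f (v.1 / v.2, v.2), fun g hg => ?_, fun v hv => ?_⟩
  · obtain ⟨f, hf, rfl⟩ := Multiset.mem_map.1 hg
    have hf := hs f hf
    obtain ⟨g, hg, hg'⟩ := hf.value
    obtain ⟨g₁, hg₁, hg₁'⟩ := hf.slope
    refine ⟨fun v hv => analyticAt_snd.mul ?_, ⟨_, analyticAt_id.mul hg, ?_⟩, ⟨g₁, hg₁, ?_⟩⟩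
    · exact AnalyticAt.fun_comp (g := f) (f := fun v : ℝ × ℝ => (v.1 / v.2, v.2))
        (hf.analyticOnNhd _ (hmem v hv))
        ((analyticAt_fst.div analyticAt_snd hv.2.1.ne').prod analyticAt_snd)
    · filter_upwards [hg'] with y hy
      simp [hy]
    · filter_upwards [hg₁', hf.eventually_analyticAt hδ, self_mem_nhdsWithin] with y h1 h2 h0
      have h0 : y ≠ 0 := ne_of_gt h0
      rw [← h1, partialXAtZero_eq_fderiv h2.differentiableAt]
      have h3 : HasDerivAt (fun x : ℝ => (x / y, y)) (1 / y, 0) 0 :=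
        ((hasDerivAt_id (0 : ℝ)).div_const y).prodMk (hasDerivAt_const _ _)
      have h2' : HasFDerivAt f (fderiv ℝ f (0, y)) ((0 : ℝ) / y, y) := by
        rw [zero_div]; exact h2.differentiableAt.hasFDerivAt
      have h4 := HasFDerivAt.comp_hasDerivAt (0 : ℝ) (f := fun x : ℝ => (x / y, y)) h2' h3
      have h5 := (h4.const_mul y).deriv
      refine h5.trans ?_
      rw [← smul_eq_mul, ← map_smul]
      simp [h0]
  · have hv' := hmem v hv
    have h1 : p (v.1 / v.2 * v.2, v.2) = (q (v.1 / v.2, v.2)).scaleRoots v.2 := hS hv'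
    rw [div_mul_cancel₀ _ hv.2.1.ne'] at h1
    rw [h1, hs' _ hv', scaleRoots_multiset_prod_X_sub_C s (fun f => f (v.1 / v.2, v.2)),
      Multiset.map_map]
    rfl

/-! ### Centering and nontrivial factorization -/

theorem coeff_comp_X_add_C (p : Polynomial ℝ) (c : ℝ) (k : ℕ) :
    (p.comp (Polynomial.X + Polynomial.C c)).coeff k
      = ∑ i ∈ Finset.range (p.natDegree + 1), p.coeff i * (c ^ (i - k) * (i.choose k : ℝ)) := by
  rw [Polynomial.comp, Polynomial.eval₂_eq_sum_range, Polynomial.finsetSum_coeff]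
  refine Finset.sum_congr rfl fun i _ => ?_
  rw [Polynomial.coeff_C_mul, Polynomial.coeff_X_add_C_pow]

/-- The Tschirnhausen transformation. -/
theorem HyperbolicFamily.exists_centered {E : Type*} [NormedAddCommGroup E] [NormedSpace ℝ E]
    {n : ℕ} {p : E → Polynomial ℝ} (hp : HyperbolicFamily (n + 1) p) :
    ∃ (q : E → Polynomial ℝ) (c : E → ℝ), HyperbolicFamily (n + 1) q ∧ AnalyticAt ℝ c 0 ∧
      (∀ v, (q v).coeff n = 0) ∧
      ∀ v, p v = (q v).comp (Polynomial.X - Polynomial.C (c v)) := by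
  -- This is the mean of the roots, as `(p v).coeff n` is minus their sum.
  let c : E → ℝ := fun v => (-1 / (n + 1 : ℝ)) * (p v).coeff n
  have hc : AnalyticAt ℝ c 0 := analyticAt_const.mul (hp.analyticAt n)
  refine ⟨fun v => (p v).comp (Polynomial.X + Polynomial.C (c v)), c, ⟨fun v => ?_, fun v => ?_,
    fun k => ?_, ?_⟩, hc, fun v => ?_, fun v => ?_⟩
  · exact (hp.monic v).comp_X_add_C _
  · rw [Polynomial.natDegree_comp, Polynomial.natDegree_X_add_C, mul_one, hp.natDegree_eq]
  · simp only [coeff_comp_X_add_C, hp.natDegree_eq]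
    exact Finset.analyticAt_fun_sum _ fun i _ =>
      (hp.analyticAt i).mul ((hc.pow _).mul analyticAt_const)
  · exact hp.splits.mono fun v hv => hv.comp_X_add_C _
  · have h1 := (hp.monic v).coeff_natDegree
    rw [hp.natDegree_eq] at h1
    rw [coeff_comp_X_add_C, hp.natDegree_eq, Finset.sum_range_succ, Finset.sum_range_succ,
      Finset.sum_eq_zero, h1]
    · have : (n + 1 : ℝ) ≠ 0 := by positivity
      simp [c]
      field_simp
      ring
    · intro i hi
      simp [Nat.choose_eq_zero_of_lt (Finset.mem_range.1 hi)]
  · simp [Polynomial.comp_assoc]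

theorem HyperbolicFamily.eq_X_pow {E : Type*} [NormedAddCommGroup E] [NormedSpace ℝ E]
    {d : ℕ} {p : E → Polynomial ℝ} (hp : HyperbolicFamily d p) {v : E}
    (h : ∀ i < d, (p v).coeff i = 0) : p v = Polynomial.X ^ d := by
  rw [← monicOfCoeffs_coeff (hp.monic v) (hp.natDegree_eq v), monicOfCoeffs,
    Finset.sum_eq_zero, add_zero]
  intro i hi
  simp [h i (Finset.mem_range.1 hi)]

/-- A centered hyperbolic family which is not `X ^ d` at the base point factors nontrivially. -/
theorem HyperbolicFamily.exists_nontrivial_factorization {E : Type*} [NormedAddCommGroup E]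
    [NormedSpace ℝ E] {n : ℕ} {p : E → Polynomial ℝ} (hp : HyperbolicFamily (n + 1) p)
    (hc : (p 0).coeff n = 0) {j : ℕ} (hj : j < n + 1) (hpj : (p 0).coeff j ≠ 0) :
    ∃ (k m : ℕ) (q r : E → Polynomial ℝ), k < n + 1 ∧ m < n + 1 ∧ HyperbolicFamily k q ∧
      HyperbolicFamily m r ∧ ∀ᶠ v in 𝓝 (0 : E), p v = q v * r v := by
  have hs : (p 0).Splits := hp.splits.self_of_nhds
  have hne : p 0 ≠ 0 := (hp.monic 0).ne_zero
  obtain ⟨r, hr⟩ := hs.exists_eval_eq_zero (by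
    rw [Polynomial.degree_eq_natDegree hne, hp.natDegree_eq]
    exact_mod_cast Nat.succ_ne_zero n)
  obtain ⟨R, hR, hRd⟩ := Polynomial.exists_eq_pow_rootMultiplicity_mul_and_not_dvd (p 0) hne r
  set k := (p 0).rootMultiplicity r with hk
  have hk0 : 0 < k := (Polynomial.rootMultiplicity_pos hne).2 hr
  have hXm : ((Polynomial.X - Polynomial.C r) ^ k).Monic := (Polynomial.monic_X_sub_C r).pow k
  have hRm : R.Monic := hXm.of_mul_monic_left (hR ▸ hp.monic 0)
  have hXd : ((Polynomial.X - Polynomial.C r) ^ k).natDegree = k := by simp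
  have hdeg : k + R.natDegree = n + 1 := by
    rw [← hp.natDegree_eq 0, hR, hXm.natDegree_mul hRm, hXd]
  -- If the cofactor were constant, `r` would be the only root; centering then forces `r = 0` and `p
  -- 0 = X ^ (n + 1)`, contrary to `hpj`.
  have hR0 : R.natDegree ≠ 0 := by
    intro h0
    have hR1 : R = 1 := hRm.natDegree_eq_zero.1 h0
    rw [hR1, mul_one, show k = n + 1 by omega] at hR
    have h1 : (p 0).coeff n = (-r) ^ (n + 1 - n) * ((n + 1).choose n : ℝ) := by
      rw [hR, sub_eq_add_neg, ← Polynomial.C_neg, Polynomial.coeff_X_add_C_pow]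
    rw [hc] at h1
    have hr0 : r = 0 := by
      have : ((n : ℝ) + 1) ≠ 0 := by positivity
      simpa [this] using h1
    rw [hr0, Polynomial.C_0, sub_zero] at hR
    rw [hR, Polynomial.coeff_X_pow, if_neg hj.ne] at hpj
    exact hpj rfl
  have hco : IsCoprime ((Polynomial.X - Polynomial.C r) ^ k) R :=
    IsCoprime.pow_left ((Polynomial.irreducible_X_sub_C r).coprime_iff_not_dvd.2 hRd)
  obtain ⟨q, s, h1, h2, h3⟩ := HyperbolicFamily.exists_factorization (hdeg ▸ hp) hXm hRm hXd rfl
    hco hR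
  exact ⟨k, _, q, s, by omega, by omega, h1, h2, h3⟩

/-! ### Restriction to the `y`-axis and powers of `x` -/

theorem eventually_axis_of_eventually {P : ℝ × ℝ → Prop} (h : ∀ᶠ v in 𝓝 (0 : ℝ × ℝ), P v) :
    ∀ᶠ y in 𝓝 (0 : ℝ), P (0, y) := by
  have : Tendsto (fun y : ℝ => ((0 : ℝ), y)) (𝓝 0) (𝓝 (0 : ℝ × ℝ)) :=
    (Continuous.prodMk_right (0 : ℝ)).tendsto 0
  exact this.eventually h

theorem eventually_of_eventually_axis {P : ℝ × ℝ → Prop} (h : ∀ᶠ y in 𝓝 (0 : ℝ), P (0, y)) :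
    ∀ᶠ v in 𝓝 (0 : ℝ × ℝ), v.1 = 0 → P v := by
  filter_upwards [(continuous_snd.tendsto (0 : ℝ × ℝ)).eventually h] with v hv h0
  have : v = (0, v.2) := Prod.ext h0 rfl
  rwa [this]

theorem AnalyticAt.comp_axis {f : ℝ × ℝ → ℝ} (hf : AnalyticAt ℝ f 0) :
    AnalyticAt ℝ (fun y : ℝ => f (0, y)) 0 :=
  AnalyticAt.fun_comp (g := f) (f := fun y : ℝ => ((0 : ℝ), y)) hf
    (analyticAt_const.prod analyticAt_id)

theorem fst_ne_zero : ContinuousLinearMap.fst ℝ ℝ ℝ ≠ 0 := fun h => by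
  simpa using congrArg (fun l => l ((1 : ℝ), (0 : ℝ))) h

theorem snd_ne_zero : ContinuousLinearMap.snd ℝ ℝ ℝ ≠ 0 := fun h => by
  simpa using congrArg (fun l => l ((0 : ℝ), (1 : ℝ))) h

/-- The finite order along the line `t ↦ t • v` makes the extraction terminate: each division by `x`
lowers it. -/
theorem AnalyticAt.exists_eq_fst_pow_mul_of_order {v : ℝ × ℝ} (K : ℕ) {a : ℝ × ℝ → ℝ}
    (ha : AnalyticAt ℝ a 0) (hK : analyticOrderAt (fun t : ℝ => a (t • v)) 0 = K) :
    ∃ (k : ℕ) (b : ℝ × ℝ → ℝ), AnalyticAt ℝ b 0 ∧ (∀ᶠ w in 𝓝 (0 : ℝ × ℝ), a w = w.1 ^ k * b w) ∧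
      ¬ ∀ᶠ y in 𝓝 (0 : ℝ), b (0, y) = 0 := by
  induction K using Nat.strong_induction_on generalizing a with
  | _ K ih =>
    by_cases hz : ∀ᶠ y in 𝓝 (0 : ℝ), a (0, y) = 0
    · obtain ⟨h, hh, hah⟩ := ha.exists_eq_linear_mul (ContinuousLinearMap.fst ℝ ℝ ℝ)
        (eventually_of_eventually_axis (P := fun v => a v = 0) hz)
      have hline : AnalyticAt ℝ (fun t : ℝ => t • v) 0 := analyticAt_id.smul analyticAt_const
      have hl1 : AnalyticAt ℝ (fun t : ℝ => (t • v).1) 0 := analyticAt_fst.fun_comp hline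
      have hl2 : AnalyticAt ℝ (fun t : ℝ => h (t • v)) 0 :=
        AnalyticAt.fun_comp (g := h) (f := fun t : ℝ => t • v) (by simpa using hh) hline
      have hlt : Tendsto (fun t : ℝ => t • v) (𝓝 0) (𝓝 0) := by
        simpa using hline.continuousAt.tendsto
      have horder : (K : ℕ∞) = analyticOrderAt (fun t : ℝ => (t • v).1) 0
          + analyticOrderAt (fun t : ℝ => h (t • v)) 0 := by
        rw [← hK, ← analyticOrderAt_mul hl1 hl2]
        exact analyticOrderAt_congr (hlt.eventually hah)
      have h1 : analyticOrderAt (fun t : ℝ => (t • v).1) 0 ≠ 0 :=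
        hl1.analyticOrderAt_ne_zero.2 (by simp)
      generalize analyticOrderAt (fun t : ℝ => (t • v).1) 0 = A at horder h1
      generalize hB : analyticOrderAt (fun t : ℝ => h (t • v)) 0 = B at horder
      have hAt : A ≠ ⊤ := by rintro rfl; simp at horder
      have hBt : B ≠ ⊤ := by rintro rfl; simp at horder
      lift A to ℕ using hAt
      lift B to ℕ using hBt
      have h2 : K = A + B := by exact_mod_cast horder
      have h3 : A ≠ 0 := by exact_mod_cast h1
      obtain ⟨k, b, hb, hab, hb0⟩ := ih B (by omega) hh hB
      refine ⟨k + 1, b, hb, ?_, hb0⟩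
      filter_upwards [hah, hab] with w h4 h5
      rw [h4, h5, pow_succ']
      simp [mul_assoc]
    · exact ⟨0, a, ha, by simp, hz⟩

/-- Extraction of the largest power of `x` from an analytic function of two variables. -/
theorem AnalyticAt.exists_eq_fst_pow_mul {a : ℝ × ℝ → ℝ} (ha : AnalyticAt ℝ a 0)
    (h0 : ¬ ∀ᶠ w in 𝓝 (0 : ℝ × ℝ), a w = 0) :
    ∃ (k : ℕ) (b : ℝ × ℝ → ℝ), AnalyticAt ℝ b 0 ∧ (∀ᶠ w in 𝓝 (0 : ℝ × ℝ), a w = w.1 ^ k * b w) ∧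
      ¬ ∀ᶠ y in 𝓝 (0 : ℝ), b (0, y) = 0 := by
  obtain ⟨ε, hε, hball⟩ := Metric.eventually_nhds_iff_ball.1 ha.eventually_analyticAt
  -- On the segment from the origin to a point `v` with `a v ≠ 0`, the identity theorem excludes
  -- infinite order at the origin.
  obtain ⟨v, hv, hav⟩ : ∃ v ∈ Metric.ball (0 : ℝ × ℝ) ε, a v ≠ 0 := by
    by_contra! h
    exact h0 (Metric.eventually_nhds_iff_ball.2 ⟨ε, hε, h⟩)
  let T : Set ℝ := {t | t • v ∈ Metric.ball (0 : ℝ × ℝ) ε}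
  have hT : Convex ℝ T := (convex_ball (0 : ℝ × ℝ) ε).linear_preimage
    (LinearMap.toSpanSingleton ℝ (ℝ × ℝ) v)
  have hg : AnalyticOnNhd ℝ (fun t : ℝ => a (t • v)) T := fun t ht =>
    AnalyticAt.fun_comp (g := a) (f := fun t : ℝ => t • v) (hball _ ht)
      (analyticAt_id.smul analyticAt_const)
  have h0T : (0 : ℝ) ∈ T := by simpa [T] using hε
  have h1T : (1 : ℝ) ∈ T := by simpa [T] using hv
  have hfin : analyticOrderAt (fun t : ℝ => a (t • v)) 0 ≠ ⊤ := by
    intro h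
    have := hg.eqOn_zero_of_preconnected_of_eventuallyEq_zero hT.isPreconnected h0T
      (analyticOrderAt_eq_top.1 h) h1T
    simp [hav] at this
  obtain ⟨K, hK⟩ := ENat.ne_top_iff_exists.1 hfin
  exact ha.exists_eq_fst_pow_mul_of_order K hK.symm

/-! ### The nested inductions -/

/-- The induction variable is the order in `y` of one coefficient on the axis. The blow-up fixes the
axis pointwise, and dividing the roots by `y` removes `y ^ (n + 2 - j)` from this coefficient, so
the process stops at a family that factors at the origin. -/
theorem HyperbolicFamily.hornSplit_of_order {n : ℕ}
    (IH : ∀ m < n + 2, ∀ p : ℝ × ℝ → Polynomial ℝ, HyperbolicFamily m p → HornSplit p) (m : ℕ)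
    {p : ℝ × ℝ → Polynomial ℝ} (hp : HyperbolicFamily (n + 2) p)
    (hc : ∀ᶠ v in 𝓝 (0 : ℝ × ℝ), (p v).coeff (n + 1) = 0) {j : ℕ} (hj : j < n + 2)
    (hm : analyticOrderAt (fun y : ℝ => (p (0, y)).coeff j) 0 = m) : HornSplit p := by
  induction m using Nat.strong_induction_on generalizing p with
  | _ m ih =>
    by_cases hi : ∃ i < n + 2, (p 0).coeff i ≠ 0
    · obtain ⟨i, hi, hpi⟩ := hi
      obtain ⟨k, l, q, r, hk, hl, hq, hr, hpqr⟩ :=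
        hp.exists_nontrivial_factorization hc.self_of_nhds hi hpi
      exact (IH k hk q hq).of_mul (IH l hl r hr) hpqr
    · push Not at hi
      let φ : ℝ × ℝ → ℝ × ℝ := fun u => (u.1 * u.2, u.2)
      have hφ : AnalyticAt ℝ φ 0 := (analyticAt_fst.mul analyticAt_snd).prod analyticAt_snd
      have hφ0 : φ 0 = 0 := by simp [φ]
      have hφt : Tendsto φ (𝓝 0) (𝓝 0) := by
        simpa only [hφ0] using hφ.continuousAt.tendsto
      have hpφ : HyperbolicFamily (n + 2) (fun u => p (φ u)) :=
        ⟨fun u => hp.monic _, fun u => hp.natDegree_eq _, fun k =>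
          AnalyticAt.fun_comp (g := fun v => (p v).coeff k) (f := φ)
            (by rw [hφ0]; exact hp.analyticAt k) hφ, hφt.eventually hp.splits⟩
      obtain ⟨q, hq, hqc, hpq⟩ := hpφ.exists_scaleRoots snd_ne_zero (hφt.eventually hc)
        (Eventually.of_forall fun u hu k hk => by
          have hu : u.2 = 0 := hu
          have : φ u = 0 := by simp [φ, hu]
          rw [this]
          exact hi k hk)
      refine HornSplit.of_blowup ?_ hpq
      have hqj : AnalyticAt ℝ (fun y : ℝ => (q (0, y)).coeff j) 0 := (hq.analyticAt j).comp_axis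
      have hpow : AnalyticAt ℝ (fun y : ℝ => y ^ (n + 2 - j)) 0 := analyticAt_id.pow _
      have horder : (m : ℕ∞) = analyticOrderAt (fun y : ℝ => (q (0, y)).coeff j) 0
          + analyticOrderAt (fun y : ℝ => y ^ (n + 2 - j)) 0 := by
        rw [← hm, ← analyticOrderAt_mul hqj hpow]
        refine analyticOrderAt_congr ?_
        filter_upwards [eventually_axis_of_eventually hpq] with y hy
        have h1 := congrArg (fun P => P.coeff j) hy
        simpa [φ, Polynomial.coeff_scaleRoots, hq.natDegree_eq] using h1
      have h1 : analyticOrderAt (fun y : ℝ => y ^ (n + 2 - j)) 0 ≠ 0 :=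
        hpow.analyticOrderAt_ne_zero.2 (zero_pow (by omega))
      generalize analyticOrderAt (fun y : ℝ => y ^ (n + 2 - j)) 0 = A at horder h1
      generalize hB : analyticOrderAt (fun y : ℝ => (q (0, y)).coeff j) 0 = B at horder
      have hAt : A ≠ ⊤ := by rintro rfl; simp at horder
      have hBt : B ≠ ⊤ := by rintro rfl; simp at horder
      lift A to ℕ using hAt
      lift B to ℕ using hBt
      have h2 : m = B + A := by exact_mod_cast horder
      have h3 : A ≠ 0 := by exact_mod_cast h1
      exact ih B (by omega) hq hqc hB

/-- Dividing the roots by `x` lowers the exponent `k` by `n + 2 - j`. It is possible as long as all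
lower coefficients vanish on the axis; otherwise `HyperbolicFamily.hornSplit_of_order` applies,
possibly with another coefficient. -/
theorem HyperbolicFamily.hornSplit_of_fst_pow {n : ℕ}
    (IH : ∀ m < n + 2, ∀ p : ℝ × ℝ → Polynomial ℝ, HyperbolicFamily m p → HornSplit p) (k : ℕ)
    {p : ℝ × ℝ → Polynomial ℝ} (hp : HyperbolicFamily (n + 2) p)
    (hc : ∀ᶠ v in 𝓝 (0 : ℝ × ℝ), (p v).coeff (n + 1) = 0) {j : ℕ} (hj : j < n + 2)
    {b : ℝ × ℝ → ℝ} (hb : AnalyticAt ℝ b 0)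
    (hpb : ∀ᶠ v in 𝓝 (0 : ℝ × ℝ), (p v).coeff j = v.1 ^ k * b v)
    (hb0 : ¬ ∀ᶠ y in 𝓝 (0 : ℝ), b (0, y) = 0) : HornSplit p := by
  induction k using Nat.strong_induction_on generalizing p with
  | _ k ih =>
    by_cases hi : ∃ i < n + 2, ¬ ∀ᶠ y in 𝓝 (0 : ℝ), (p (0, y)).coeff i = 0
    · obtain ⟨i, hi, hpi⟩ := hi
      rw [← analyticOrderAt_eq_top] at hpi
      obtain ⟨K, hK⟩ := ENat.ne_top_iff_exists.1 hpi
      exact hp.hornSplit_of_order IH K hc hi hK.symm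
    · push Not at hi
      have hi' : ∀ᶠ v in 𝓝 (0 : ℝ × ℝ), v.1 = 0 → ∀ i < n + 2, (p v).coeff i = 0 := by
        refine eventually_of_eventually_axis (P := fun v => ∀ i < n + 2, (p v).coeff i = 0) ?_
        have : ∀ᶠ y in 𝓝 (0 : ℝ), ∀ i ∈ Finset.range (n + 2), (p (0, y)).coeff i = 0 := by
          rw [eventually_all_finset]
          exact fun i h => hi i (Finset.mem_range.1 h)
        exact this.mono fun y hy i h => hy i (Finset.mem_range.2 h)
      obtain ⟨q, hq, hqc, hpq⟩ := hp.exists_scaleRoots fst_ne_zero hc hi'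
      refine HornSplit.of_scaleRoots_fst ?_ hpq
      have hcoef : ∀ᶠ v in 𝓝 (0 : ℝ × ℝ),
          v.1 ^ k * b v = (q v).coeff j * v.1 ^ (n + 2 - j) := by
        filter_upwards [hpb, hpq] with v h1 h2
        rw [← h1, h2, Polynomial.coeff_scaleRoots, hq.natDegree_eq]
        rfl
      rcases le_or_gt (n + 2 - j) k with hk | hk
      · refine ih (k - (n + 2 - j)) (by omega) hq hqc ?_
        refine (hq.analyticAt j).eventually_eq_of_linear_ne_zero fst_ne_zero
          ((analyticAt_fst.pow _).mul hb) ?_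
        filter_upwards [hcoef] with v h1 h2
        have h2 : v.1 ≠ 0 := h2
        rw [← Nat.sub_add_cancel hk, pow_add] at h1
        apply mul_right_cancel₀ (pow_ne_zero (n + 2 - j) h2)
        rw [← h1]
        ring
      -- If `k < n + 2 - j`, cancelling `x ^ k` leaves a positive power of `x` in `b`, which would
      -- then vanish on the axis.
      · refine absurd ?_ hb0
        have : ∀ᶠ v in 𝓝 (0 : ℝ × ℝ), b v = v.1 ^ (n + 2 - j - k) * (q v).coeff j := by
          refine hb.eventually_eq_of_linear_ne_zero fst_ne_zero
            ((analyticAt_fst.pow _).mul (hq.analyticAt j)) ?_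
          filter_upwards [hcoef] with v h1 h2
          have h2 : v.1 ≠ 0 := h2
          rw [← Nat.sub_add_cancel hk.le, pow_add] at h1
          apply mul_left_cancel₀ (pow_ne_zero k h2)
          rw [h1]
          ring
        filter_upwards [eventually_axis_of_eventually this] with y hy
        rw [hy, zero_pow (by omega), zero_mul]

/-- Every hyperbolic family in two variables splits into horn roots. -/
theorem HyperbolicFamily.hornSplit (d : ℕ) {p : ℝ × ℝ → Polynomial ℝ}
    (hp : HyperbolicFamily d p) : HornSplit p := by
  induction d using Nat.strong_induction_on generalizing p with
  | _ d IH =>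
    match d with
    | 0 => exact hornSplit_X_pow (d := 0) (Eventually.of_forall fun v => hp.eq_X_pow (by simp))
    | 1 =>
      obtain ⟨q, c, hq, hc, hq0, hpq⟩ := hp.exists_centered
      refine HornSplit.of_comp (hornSplit_X_pow (d := 1) (Eventually.of_forall fun v =>
        hq.eq_X_pow fun i hi => ?_)) hc (Eventually.of_forall hpq)
      rw [show i = 0 by omega]
      exact hq0 v
    | n + 2 =>
      obtain ⟨q, c, hq, hc, hq0, hpq⟩ := hp.exists_centered
      refine HornSplit.of_comp ?_ hc (Eventually.of_forall hpq)
      by_cases hi : ∃ i < n + 2, ¬ ∀ᶠ v in 𝓝 (0 : ℝ × ℝ), (q v).coeff i = 0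
      · obtain ⟨i, hi, hqi⟩ := hi
        obtain ⟨k, b, hb, hqb, hb0⟩ := (hq.analyticAt i).exists_eq_fst_pow_mul hqi
        exact hq.hornSplit_of_fst_pow (fun m hm p hp => IH m hm hp) k
          (Eventually.of_forall hq0) hi hb hqb hb0
      · push Not at hi
        refine hornSplit_X_pow (d := n + 2) ?_
        have : ∀ᶠ v in 𝓝 (0 : ℝ × ℝ), ∀ i ∈ Finset.range (n + 2), (q v).coeff i = 0 := by
          rw [eventually_all_finset]
          exact fun i h => hi i (Finset.mem_range.1 h)
        exact this.mono fun v hv => hq.eq_X_pow fun i h => hv i (Finset.mem_range.2 h)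

/-! ### Uniqueness of analytic splittings on a horn -/

theorem isPreconnected_hornSet {N : ℕ} {δ : ℝ} : IsPreconnected (hornSet N δ) := by
  have : hornSet N δ = (fun p : ℝ × ℝ => (p.1 * p.2 ^ N, p.2)) ''
      (Set.Ioo (-1) 1 ×ˢ Set.Ioo 0 δ) := by
    ext ⟨x, y⟩
    simp only [Set.mem_image, Set.mem_prod, Prod.exists, Prod.mk.injEq]
    constructor
    · rintro ⟨h1, h2, h3⟩
      have hy : 0 < y ^ N := pow_pos h2 N
      refine ⟨x / y ^ N, y, ⟨abs_lt.1 ?_, h2, h3⟩, div_mul_cancel₀ _ hy.ne', rfl⟩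
      rw [abs_div, abs_of_pos hy, div_lt_one hy]
      exact h1
    · rintro ⟨t, y', ⟨h1, h2, h3⟩, rfl, rfl⟩
      refine ⟨?_, h2, h3⟩
      have hy : 0 < y' ^ N := pow_pos h2 N
      change |t * y' ^ N| < y' ^ N
      rw [abs_mul, abs_of_pos hy]
      nlinarith [abs_lt.2 h1]
  rw [this]
  refine (isPreconnected_Ioo.prod isPreconnected_Ioo).image _ ?_
  exact Continuous.continuousOn (by fun_prop)

/-- Analytic functions on a connected open set form a ring without zero divisors. -/
theorem exists_eqOn_zero_of_prod_eq_zero {E ι : Type*} [NormedAddCommGroup E] [NormedSpace ℝ E]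
    {H : Set E} (hH : IsOpen H) (hc : IsPreconnected H) (hne : H.Nonempty) {u : ι → E → ℝ}
    (hu : ∀ j, AnalyticOnNhd ℝ (u j) H) (t : Finset ι)
    (h : ∀ v ∈ H, ∏ j ∈ t, u j v = 0) : ∃ j ∈ t, ∀ v ∈ H, u j v = 0 := by
  classical
  induction t using Finset.induction_on with
  | empty =>
    obtain ⟨v, hv⟩ := hne
    simpa using h v hv
  | insert j t hj ih =>
    by_cases hz : ∀ v ∈ H, u j v = 0
    · exact ⟨j, Finset.mem_insert_self _ _, hz⟩
    push Not at hz
    obtain ⟨v, hv, huv⟩ := hz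
    have hprod : AnalyticOnNhd ℝ (fun v => ∏ j ∈ t, u j v) H :=
      Finset.analyticOnNhd_fun_prod _ fun j _ => hu j
    -- Near a point where `u j` is nonzero the remaining product vanishes; the identity theorem
    -- spreads this over `H`.
    have h0 : (fun v => ∏ j ∈ t, u j v) =ᶠ[𝓝 v] 0 := by
      filter_upwards [(hu j v hv).continuousAt.eventually_ne huv, hH.mem_nhds hv] with w h1 h2
      have h3 := h w h2
      rw [Finset.prod_insert hj] at h3
      exact (mul_eq_zero.1 h3).resolve_left h1
    obtain ⟨i, hi, hi'⟩ := ih fun w hw =>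
      hprod.eqOn_zero_of_preconnected_of_eventuallyEq_zero hc hv h0 hw
    exact ⟨i, Finset.mem_insert_of_mem hi, hi'⟩

/-! ### Assembling the theorem -/

theorem monicFamily_eq_monicOfCoeffs (d : ℕ) (a : ℕ → ℝ × ℝ → ℝ) (p : ℝ × ℝ) :
    monicFamily d a p = monicOfCoeffs d (fun k => a (d - k) p) := by
  unfold monicFamily monicOfCoeffs
  congr 1
  refine Finset.sum_nbij' (fun i => d - i) (fun k => d - k) ?_ ?_ ?_ ?_ ?_
  · intro i hi
    rw [Finset.mem_Icc] at hi
    exact Finset.mem_range.2 (by omega)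
  · intro k hk
    rw [Finset.mem_range] at hk
    exact Finset.mem_Icc.2 (by omega)
  · intro i hi
    rw [Finset.mem_Icc] at hi
    omega
  · intro k hk
    rw [Finset.mem_range] at hk
    omega
  · intro i hi
    rw [Finset.mem_Icc] at hi
    simp only [show d - (d - i) = i by omega]

theorem hyperbolicFamily_monicFamily {d : ℕ} {a : ℕ → ℝ × ℝ → ℝ} {U : Set (ℝ × ℝ)}
    (hU : IsOpen U) (h0 : ((0 : ℝ), (0 : ℝ)) ∈ U)
    (ha : ∀ i ∈ Finset.Icc 1 d, AnalyticOnNhd ℝ (a i) U)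
    (hhyp : ∀ p ∈ U, IsHyperbolicPoly (monicFamily d a p)) :
    HyperbolicFamily d (monicFamily d a) := by
  refine ⟨fun v => ?_, fun v => ?_, fun k => ?_, ?_⟩
  · rw [monicFamily_eq_monicOfCoeffs]; exact monic_monicOfCoeffs _ _
  · rw [monicFamily_eq_monicOfCoeffs]; exact natDegree_monicOfCoeffs _ _
  · simp only [monicFamily_eq_monicOfCoeffs]
    exact analyticAt_coeff_monicOfCoeffs (c := fun v k => a (d - k) v)
      (fun k hk => ha _ (Finset.mem_Icc.2 (by omega)) _ h0) k
  · filter_upwards [hU.mem_nhds h0] with v hv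
    exact Polynomial.splits_of_forall_complex_root (hhyp v hv)

/-- Stated for all small `η` so that finitely many roots can share one `η`; the strict `η < ε`
leaves room for compactness of a closed interval. -/
theorem HornRoot.eventually_slope {N : ℕ} {δ : ℝ} {f : ℝ × ℝ → ℝ} (hf : HornRoot N δ f) :
    ∀ᶠ η in 𝓝[>] (0 : ℝ), ∃ (ε : ℝ) (g : ℝ → ℝ), η < ε ∧ AnalyticOnNhd ℝ g (Set.Ioo (-ε) ε) ∧
      ∀ y ∈ Set.Ioo 0 ε, g y = partialXAtZero f y := by
  obtain ⟨g, hg, hfg⟩ := hf.slope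
  obtain ⟨ε₁, h1, h1'⟩ := Metric.eventually_nhds_iff_ball.1 hg.eventually_analyticAt
  obtain ⟨ε₂, h2, h2'⟩ := mem_nhdsGT_iff_exists_Ioo_subset.1 hfg
  have h2 : 0 < ε₂ := h2
  filter_upwards [Ioo_mem_nhdsGT (lt_min h1 h2)] with η hη
  refine ⟨min ε₁ ε₂, g, hη.2, fun y hy => h1' y ?_, fun y hy => (h2' ?_).symm⟩
  · rw [mem_ball_zero_iff, Real.norm_eq_abs]
    exact (abs_lt.2 hy).trans_le (min_le_left _ _)
  · exact ⟨hy.1, hy.2.trans_le (min_le_right _ _)⟩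

theorem HornSplitOn.exists_fin {N : ℕ} {δ : ℝ} (hδ : 0 < δ) {d : ℕ} {p : ℝ × ℝ → Polynomial ℝ}
    (hd : ∀ v, (p v).natDegree = d) (hp : HornSplitOn N δ p) :
    ∃ F : Fin d → ℝ × ℝ → ℝ, (∀ i, HornRoot N δ (F i)) ∧
      ∀ v ∈ hornSet N δ, ∀ z : ℝ, (p v).eval z = ∏ i, (z - F i v) := by
  obtain ⟨s, hs, hs'⟩ := hp
  obtain ⟨L, rfl⟩ : ∃ L : List (ℝ × ℝ → ℝ), (L : Multiset (ℝ × ℝ → ℝ)) = s :=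
    ⟨s.toList, s.coe_toList⟩
  have hL : L.length = d := by
    have h1 := hs' _ (mem_hornSet_axis (N := N) (δ := δ) (y := δ / 2)
      ⟨by positivity, by linarith⟩)
    have h2 := congrArg Polynomial.natDegree h1
    rw [hd] at h2
    have h3 := Polynomial.natDegree_multiset_prod_X_sub_C_eq_card
      (((L : Multiset (ℝ × ℝ → ℝ))).map fun f => f (0, δ / 2))
    rw [Multiset.map_map] at h3
    exact (h2.trans h3).symm ▸ by simp
  subst hL
  refine ⟨fun i => L.get i, fun i => hs _ (List.get_mem L i), fun v hv z => ?_⟩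
  rw [hs' v hv, ← List.prod_ofFn]
  have h1 : List.ofFn (fun i => z - L.get i v) = L.map (fun f => z - f v) := by
    conv_rhs => rw [← List.ofFn_get L, List.map_ofFn]
    rfl
  rw [h1, Polynomial.eval_multiset_prod, Multiset.map_map]
  simp

/-- Evaluating both factorizations at `z = f i v` gives `∏ j, (f i v - F j v) = 0`, and one factor
must vanish identically. -/
theorem IsAnalyticSplitting.exists_eqOn {d : ℕ} {a : ℕ → ℝ × ℝ → ℝ} {N : ℕ} {δ : ℝ}
    (hδ : 0 < δ) {f F : Fin d → ℝ × ℝ → ℝ} (hf : IsAnalyticSplitting d a (hornSet N δ) f)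
    (hF : IsAnalyticSplitting d a (hornSet N δ) F) (i : Fin d) :
    ∃ j, ∀ v ∈ hornSet N δ, f i v = F j v := by
  obtain ⟨j, -, hj⟩ := exists_eqOn_zero_of_prod_eq_zero (u := fun j v => f i v - F j v)
    (isOpen_hornSet N δ) isPreconnected_hornSet
    ⟨_, mem_hornSet_axis (y := δ / 2) ⟨by positivity, by linarith⟩⟩
    (fun j => (hf.1 i).sub (hF.1 j)) Finset.univ (fun v hv => by
      rw [← hF.2 v hv, hf.2 v hv]
      exact Finset.prod_eq_zero (Finset.mem_univ i) (sub_self _))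
  exact ⟨j, fun v hv => sub_eq_zero.1 (hj v hv)⟩

theorem partialXAtZero_congr {N : ℕ} {δ : ℝ} {f g : ℝ × ℝ → ℝ}
    (h : ∀ v ∈ hornSet N δ, f v = g v) {y : ℝ} (hy : y ∈ Set.Ioo 0 δ) :
    partialXAtZero f y = partialXAtZero g y := by
  refine Filter.EventuallyEq.deriv_eq ?_
  have hcont : Tendsto (fun x : ℝ => (x, y)) (𝓝 0) (𝓝 (0, y)) :=
    (Continuous.prodMk_left y).tendsto 0
  filter_upwards [hcont.eventually ((isOpen_hornSet N δ).mem_nhds (mem_hornSet_axis hy))]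
    with x hx using h _ hx

theorem proposition3p6 (d : ℕ) (a : ℕ → ℝ × ℝ → ℝ) (U : Set (ℝ × ℝ))
    (hU : IsOpen U) (h0 : ((0 : ℝ), (0 : ℝ)) ∈ U)
    (ha : ∀ i ∈ Finset.Icc 1 d, AnalyticOnNhd ℝ (a i) U)
    (hhyp : ∀ p ∈ U, IsHyperbolicPoly (monicFamily d a p)) :
    ∃ (N₀ : ℕ) (δ₀ : ℝ), 0 < δ₀ ∧ ∀ N : ℕ, N₀ ≤ N → ∀ δ : ℝ, 0 < δ → δ ≤ δ₀ →
      hornSet N δ ⊆ U ∧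
      (∃ f : Fin d → ℝ × ℝ → ℝ, IsAnalyticSplitting d a (hornSet N δ) f) ∧
      ∀ f : Fin d → ℝ × ℝ → ℝ, IsAnalyticSplitting d a (hornSet N δ) f → ∀ i : Fin d,
        (∃ (ε : ℝ) (g : ℝ → ℝ), 0 < ε ∧ AnalyticOnNhd ℝ g (Set.Ioo (-ε) δ) ∧
          ∀ y ∈ Set.Ioo (0 : ℝ) δ, g y = partialXAtZero (f i) y) ∧
        (∃ C : ℝ, ∀ y ∈ Set.Ioo (0 : ℝ) δ, |partialXAtZero (f i) y| ≤ C) := by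
  have hp := hyperbolicFamily_monicFamily hU h0 ha hhyp
  obtain ⟨N₁, δ₁, hδ₁, hδ₁1, hS, hsplit⟩ := (hp.hornSplit d).shrink (hU.mem_nhds h0)
  obtain ⟨F, hF, hFp⟩ := hsplit.exists_fin hδ₁ hp.natDegree_eq
  obtain ⟨δ₂, hslope, hδ₂⟩ := ((eventually_all.2 fun i => (hF i).eventually_slope).and
    self_mem_nhdsWithin).exists
  have hδ₂ : 0 < δ₂ := hδ₂
  refine ⟨N₁, min δ₁ δ₂, lt_min hδ₁ hδ₂, fun N hN δ hδ hδle => ?_⟩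
  have hsub : hornSet N δ ⊆ hornSet N₁ δ₁ := hornSet_subset_hornSet hN
    (hδle.trans (min_le_left _ _)) ((hδle.trans (min_le_left _ _)).trans hδ₁1)
  have hFs : IsAnalyticSplitting d a (hornSet N δ) F :=
    ⟨fun i => (hF i).analyticOnNhd.mono hsub, fun v hv => hFp v (hsub hv)⟩
  refine ⟨hsub.trans hS, ⟨F, hFs⟩, fun f hf i => ?_⟩
  obtain ⟨j, hj⟩ := hf.exists_eqOn hδ hFs i
  obtain ⟨ε, g, hε, hg, hgF⟩ := hslope j
  have hδε : δ < ε := (hδle.trans (min_le_right _ _)).trans_lt hε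
  have hgf : ∀ y ∈ Set.Ioo (0 : ℝ) δ, g y = partialXAtZero (f i) y := fun y hy => by
    rw [partialXAtZero_congr hj hy]
    exact hgF y ⟨hy.1, hy.2.trans hδε⟩
  refine ⟨⟨ε, g, hδ.trans hδε, hg.mono (Set.Ioo_subset_Ioo_right hδε.le), hgf⟩, ?_⟩
  -- The extension `g` is continuous on all of `[0, δ]` because `δ < ε`, so it is bounded there.
  obtain ⟨C, hC⟩ := (isCompact_Icc (a := (0 : ℝ)) (b := δ)).exists_bound_of_continuousOn
    (hg.continuousOn.mono fun y hy => ⟨by linarith [hy.1], hy.2.trans_lt hδε⟩)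
  refine ⟨C, fun y hy => ?_⟩
  rw [← hgf y hy]
  exact hC y ⟨hy.1.le, hy.2.le⟩
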